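/- Throughout, logic is intuitionistic predicate logic with equality, $\perp$ is the formula $0=1$ and $\neg A$ abbreviates $A\to\perp$. All axioms are sentences, and the only rule is modus ponens under a block of universal quantifiers: from $(\forall n_1,\ldots,n_k)A$ and $(\forall n_1,\ldots,n_k)(A\to B)$ infer $(\forall n_1,\ldots,n_k)B$ ($k\ge 0$); the generalization rules are the axiom schemes $(\forall n_1,\ldots,n_k)(A\to B)\to(\forall n_2,\ldots,n_k)(A\to(\forall n_1)B)$ ($n_1$ not free in $A$) and $(\forall n_1,\ldots,n_k)(A\to B)\to(\forall n_2,\ldots,n_k)((\exists n_1)A\to B)$ ($n_1$ not free in $B$). Peano arithmetic (PA) is formulated with the non-logical axioms $A\vee\neg A$ for all formulas $A$ of first order arithmetic, besides its usual ones. Let $S$ be a theory in the language of first order arithmetic, given by a recursive set of sentences as non-logical axioms, which extends PA (every theorem of PA is a theorem of $S$). Enrich the language by one unary relation symbol $\Box$, and fix a Gödel numbering $\ulcorner\cdot\urcorner$ of the enriched language. Let $\bar n$ be the $n$th numeral. The main axioms of $S_\Box$ are the non-logical axioms of $S$ and the universal closures of: all instances of induction and of the logical axiom schemes, for formulas of the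 enriched language; the five axioms 1. $\Box\ulcorner A\vee B\urcorner\leftrightarrow\Box\ulcorner A\urcorner\vee\Box\ulcorner B\urcorner$, 2. $\Box\ulcorner A\wedge B\urcorner\leftrightarrow\Box\ulcorner A\urcorner\wedge\Box\ulcorner B\urcorner$, 3. $(\exists n)\Box\ulcorner A(\bar n)\urcorner\to\Box\ulcorner(\exists n)A(n)\urcorner$, 4. $\Box\ulcorner(\forall n)A(n)\urcorner\leftrightarrow(\forall n)\Box\ulcorner A(\bar n)\urcorner$, 5. $\Box\ulcorner A\to B\urcorner\to(\Box\ulcorner A\urcorner\to\Box\ulcorner B\urcorner)$, each of which is a single sentence that quantifies, through Gödel numbers, over all sentences $A$, $B$ (in 3 and 4: over all formulas $A$ with at most the variable $n$ free) of the enriched language; and the scheme of capture 6. $A(n_1,\ldots,n_k)\to\Box\ulcorner A(\bar n_1,\ldots,\bar n_k)\urcorner$, for every formula $A$ of the enriched language. Let ${\rm Ax}(g)$ be any formula of first order arithmetic which expresses that $g$ is the Gödel number of a main axiom (that is, for every natural number $g$, ${\rm Ax}(g)$ is true in $\mathbb N$ if and only if $g$ is the Gödel number of a main axiom) and such that PA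 proves ${\rm Ax}(\bar g)$ whenever it is true. The axioms of $S_\Box$ are the main axioms and the jump axiom $(\forall g)({\rm Ax}(g)\to\Box(g))$. Let ${\rm Prov}_{S_\Box}(g)$ be the standard arithmetical formula, built from ${\rm Ax}$, which says that there is a proof in $S_\Box$ of the sentence with Gödel number $g$ (a finite sequence of sentences, each of which satisfies ${\rm Ax}$, or is the jump axiom, or follows from earlier ones by the rule), and let ${\rm Con}(S_\Box)$ be the sentence which says that no $g$ is the Gödel number of a proof in $S_\Box$ of $0=1$. Then the sentences $$(\forall g)({\rm Prov}_{S_\Box}(g)\to\Box(g))\qquad\text{and}\qquad\Box\ulcorner{\rm Con}(S_\Box)\urcorner$$ (assertible soundness and assertible consistency) are provable in $S_\Box$. -/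

import Mathlib

namespace Assertibility

/-! ### Syntax

The language of first order arithmetic `0, S, +, ·, =`, enriched by one unary relation symbol `□`.
Formulas are well scoped de Bruijn terms: `Fml n` is the type of formulas whose free variables are
among `#0, …, #(n-1)`, and `#0` is the variable bound by the innermost quantifier. In particular
`Fml 0` is the type of sentences. All connectives except negation are primitive, as the logic is
intuitionistic. -/

/-- Terms of first order arithmetic with free variables among `#0, …, #(n-1)`. -/
inductive Tm (n : ℕ) : Type
  | var (i : Fin n) : Tm n
  | zero : Tm n
  | succ (t : Tm n) : Tm n
  | add (s t : Tm n) : Tm n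
  | mul (s t : Tm n) : Tm n

/-- Formulas of the language with `□`, with free variables among `#0, …, #(n-1)`. -/
inductive Fml : ℕ → Type
  | eq {n : ℕ} (s t : Tm n) : Fml n
  | box {n : ℕ} (t : Tm n) : Fml n
  | and {n : ℕ} (A B : Fml n) : Fml n
  | or {n : ℕ} (A B : Fml n) : Fml n
  | imp {n : ℕ} (A B : Fml n) : Fml n
  | all {n : ℕ} (A : Fml (n + 1)) : Fml n
  | ex {n : ℕ} (A : Fml (n + 1)) : Fml n

prefix:max "#" => Tm.var
infix:75 " ≐ " => Fml.eq
infixr:69 " ⋏ " => Fml.and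
infixr:68 " ⋎ " => Fml.or
infixr:60 " ⇒ " => Fml.imp
prefix:80 "∀₀ " => Fml.all
prefix:80 "∃₀ " => Fml.ex

/-- The numeral `S (S (… 0))`. -/
def num {n : ℕ} : ℕ → Tm n
  | 0 => Tm.zero
  | k + 1 => Tm.succ (num k)

/-- The canonical falsehood `0 = 1`. -/
def Fml.bot {n : ℕ} : Fml n := Tm.zero ≐ Tm.succ Tm.zero

/-- Negation is the abbreviation `A → ⊥`. -/
def Fml.neg {n : ℕ} (A : Fml n) : Fml n := A ⇒ Fml.bot

/-- `A ↔ B` is the abbreviation `(A → B) ∧ (B → A)`. -/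
def Fml.iff {n : ℕ} (A B : Fml n) : Fml n := (A ⇒ B) ⋏ (B ⇒ A)

/-- The formulas of first order arithmetic, that is, those without `□`. -/
def Fml.IsArith : {n : ℕ} → Fml n → Prop
  | _, .eq _ _ => True
  | _, .box _ => False
  | _, .and A B => A.IsArith ∧ B.IsArith
  | _, .or A B => A.IsArith ∧ B.IsArith
  | _, .imp A B => A.IsArith ∧ B.IsArith
  | _, .all A => A.IsArith
  | _, .ex A => A.IsArith

/-- Simultaneous substitution in terms. -/
def Tm.subst {n m : ℕ} (σ : Fin n → Tm m) : Tm n → Tm m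
  | .var i => σ i
  | .zero => .zero
  | .succ t => .succ (t.subst σ)
  | .add s t => .add (s.subst σ) (t.subst σ)
  | .mul s t => .mul (s.subst σ) (t.subst σ)

/-- The substitution `σ` moved under a quantifier. -/
def up {n m : ℕ} (σ : Fin n → Tm m) : Fin (n + 1) → Tm (m + 1) :=
  Fin.cases #0 (fun i => (σ i).subst (fun j => #(Fin.succ j)))

/-- Simultaneous (capture avoiding) substitution in formulas. -/
def Fml.subst : {n m : ℕ} → (Fin n → Tm m) → Fml n → Fml m
  | _, _, σ, .eq s t => .eq (s.subst σ) (t.subst σ)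
  | _, _, σ, .box t => .box (t.subst σ)
  | _, _, σ, .and A B => .and (A.subst σ) (B.subst σ)
  | _, _, σ, .or A B => .or (A.subst σ) (B.subst σ)
  | _, _, σ, .imp A B => .imp (A.subst σ) (B.subst σ)
  | _, _, σ, .all A => .all (A.subst (up σ))
  | _, _, σ, .ex A => .ex (A.subst (up σ))

/-- `A(t)`: the term `t` is put for the variable `#0` of `A`. -/
def Fml.inst {n : ℕ} (A : Fml (n + 1)) (t : Tm n) : Fml n :=
  A.subst (Fin.cases t (fun i => #i))

/-- `A(S x)`, where `x` is the variable `#0` of `A`. -/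
def Fml.atSucc {n : ℕ} (A : Fml (n + 1)) : Fml (n + 1) :=
  A.subst (Fin.cases (Tm.succ #0) (fun i => #(Fin.succ i)))

/-- The formula `A` regarded as a formula in which a new variable `#0` does not occur. -/
def Fml.weaken {n : ℕ} (A : Fml n) : Fml (n + 1) := A.subst (fun i => #(Fin.succ i))

/-- `P ⬝ ![t₀, …]` is the formula `P(t₀, …)`. -/
def Fml.app {k n : ℕ} (P : Fml k) (ts : Fin k → Tm n) : Fml n := P.subst ts

infix:90 " ⬝ " => Fml.app

/-- The universal closure `∀ … ∀ A`, with `n` quantifiers. -/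
def alls : (n : ℕ) → Fml n → Fml 0
  | 0, A => A
  | n + 1, A => alls n (∀₀ A)

/-- The formula `∀ … ∀ A`, with `j` quantifiers; `m` further variables may stay free. -/
def allsIn {m : ℕ} : (j : ℕ) → Fml (m + j) → Fml m
  | 0, A => A
  | j + 1, A => allsIn j (∀₀ A)

/-! ### Logic

There are no free variables in proofs: axioms are closed, and the only rule is modus ponens
under a block of universal quantifiers. -/

/-- The renaming that makes the innermost variable `#0` of a block of `j + 1` quantified variables
the outermost one: `#0 ↦ #j`, `#i ↦ #(i-1)` for `1 ≤ i ≤ j`; the variables outside of the block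
are kept. -/
def rot (m j : ℕ) (i : Fin (m + j + 1)) : Tm (m + j + 1) :=
  if i.val = 0 then #⟨j, by omega⟩
  else if i.val ≤ j then #⟨i.val - 1, by omega⟩
  else #i

/-- The axiom schemes of intuitionistic predicate logic with equality (to be closed universally).
The two generalization schemes are
`(∀ n₁ n₂ … nₖ)(A → B) → (∀ n₂ … nₖ)(A → (∀ n₁) B)`, `n₁` not free in `A`, and
`(∀ n₁ n₂ … nₖ)(A → B) → (∀ n₂ … nₖ)((∃ n₁) A → B)`, `n₁` not free in `B`, with `k = j + 1`. -/
inductive LogicalAxiom : {n : ℕ} → Fml n → Prop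
  | k {n : ℕ} (A B : Fml n) : LogicalAxiom (A ⇒ B ⇒ A)
  | s {n : ℕ} (A B C : Fml n) : LogicalAxiom ((A ⇒ B ⇒ C) ⇒ (A ⇒ B) ⇒ A ⇒ C)
  | andLeft {n : ℕ} (A B : Fml n) : LogicalAxiom (A ⋏ B ⇒ A)
  | andRight {n : ℕ} (A B : Fml n) : LogicalAxiom (A ⋏ B ⇒ B)
  | andIntro {n : ℕ} (A B : Fml n) : LogicalAxiom (A ⇒ B ⇒ A ⋏ B)
  | orLeft {n : ℕ} (A B : Fml n) : LogicalAxiom (A ⇒ A ⋎ B)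
  | orRight {n : ℕ} (A B : Fml n) : LogicalAxiom (B ⇒ A ⋎ B)
  | orElim {n : ℕ} (A B C : Fml n) : LogicalAxiom ((A ⇒ C) ⇒ (B ⇒ C) ⇒ A ⋎ B ⇒ C)
  | exFalso {n : ℕ} (A : Fml n) : LogicalAxiom (Fml.bot ⇒ A)
  | allElim {n : ℕ} (A : Fml (n + 1)) (t : Tm n) : LogicalAxiom (∀₀ A ⇒ A.inst t)
  | exIntro {n : ℕ} (A : Fml (n + 1)) (t : Tm n) : LogicalAxiom (A.inst t ⇒ ∃₀ A)
  | genAll {m : ℕ} (j : ℕ) (A : Fml (m + j)) (B : Fml (m + j + 1)) :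
      LogicalAxiom (allsIn (j + 1) ((A.weaken ⇒ B).subst (rot m j)) ⇒ allsIn j (A ⇒ ∀₀ B))
  | genEx {m : ℕ} (j : ℕ) (A : Fml (m + j + 1)) (B : Fml (m + j)) :
      LogicalAxiom (allsIn (j + 1) ((A ⇒ B.weaken).subst (rot m j)) ⇒ allsIn j (∃₀ A ⇒ B))
  | eqRefl {n : ℕ} (t : Tm n) : LogicalAxiom (t ≐ t)
  | eqSubst {n : ℕ} (A : Fml (n + 1)) (s t : Tm n) :
      LogicalAxiom (s ≐ t ⇒ A.inst s ⇒ A.inst t)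

/-- The sentences that follow from the set `Γ` of sentences by the rule: from
`(∀ n₁ … nₖ) A` and `(∀ n₁ … nₖ)(A → B)` infer `(∀ n₁ … nₖ) B`. -/
inductive Derivable (Γ : Set (Fml 0)) : Fml 0 → Prop
  | ax {A : Fml 0} (h : A ∈ Γ) : Derivable Γ A
  | mp (k : ℕ) (A B : Fml k) (h₁ : Derivable Γ (alls k A)) (h₂ : Derivable Γ (alls k (A ⇒ B))) :
      Derivable Γ (alls k B)

/-- The theorems of the theory in the language of first order arithmetic (without `□`) whose set of
non-logical axioms is `S`. -/
def ArithTheorem (S : Set (Fml 0)) (A : Fml 0) : Prop :=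
  Derivable ({C | ∃ (n : ℕ) (B : Fml n), LogicalAxiom B ∧ B.IsArith ∧ C = alls n B} ∪ S) A

/-- The induction scheme (to be closed universally), for all formulas. -/
inductive InductionAxiom : {n : ℕ} → Fml n → Prop
  | mk {n : ℕ} (A : Fml (n + 1)) :
      InductionAxiom (A.inst Tm.zero ⋏ ∀₀ (A ⇒ A.atSucc) ⇒ ∀₀ A)

/-- The non-logical axioms of Peano arithmetic (to be closed universally). Excluded middle for
arithmetical formulas is among them, since the underlying logic is intuitionistic. -/
inductive PAAxiom : {n : ℕ} → Fml n → Prop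
  | succNeZero {n : ℕ} (t : Tm n) : PAAxiom (Tm.succ t ≐ Tm.zero).neg
  | succInj {n : ℕ} (s t : Tm n) : PAAxiom (Tm.succ s ≐ Tm.succ t ⇒ s ≐ t)
  | addZero {n : ℕ} (t : Tm n) : PAAxiom (Tm.add t Tm.zero ≐ t)
  | addSucc {n : ℕ} (s t : Tm n) : PAAxiom (Tm.add s (Tm.succ t) ≐ Tm.succ (Tm.add s t))
  | mulZero {n : ℕ} (t : Tm n) : PAAxiom (Tm.mul t Tm.zero ≐ Tm.zero)
  | mulSucc {n : ℕ} (s t : Tm n) : PAAxiom (Tm.mul s (Tm.succ t) ≐ Tm.add (Tm.mul s t) s)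
  | induction {n : ℕ} (A : Fml n) (hA : A.IsArith) (h : InductionAxiom A) : PAAxiom A
  | em {n : ℕ} (A : Fml n) (hA : A.IsArith) : PAAxiom (A ⋎ A.neg)

/-- The set of non-logical axioms of Peano arithmetic. -/
def PA : Set (Fml 0) := {C | ∃ (n : ℕ) (B : Fml n), PAAxiom B ∧ C = alls n B}

/-! ### Gödel numbering

Tuples are coded with the injective polynomial pairing `⟨a, b⟩ = (a + b)² + a`, so that the
constructors of syntax are given by terms of the language. -/

/-- The pairing function on natural numbers. -/
def npair (a b : ℕ) : ℕ := (a + b) * (a + b) + a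

/-- The Gödel number of a term. -/
def Tm.code {n : ℕ} : Tm n → ℕ
  | .var i => npair 0 i.val
  | .zero => npair 1 0
  | .succ t => npair 2 t.code
  | .add s t => npair 3 (npair s.code t.code)
  | .mul s t => npair 4 (npair s.code t.code)

/-- The Gödel number of a formula. -/
def Fml.code : {n : ℕ} → Fml n → ℕ
  | _, .eq s t => npair 5 (npair s.code t.code)
  | _, .box t => npair 6 t.code
  | _, .and A B => npair 7 (npair A.code B.code)
  | _, .or A B => npair 8 (npair A.code B.code)
  | _, .imp A B => npair 9 (npair A.code B.code)
  | _, .all A => npair 10 A.code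
  | _, .ex A => npair 11 A.code

/-- The numeral `⌜A⌝` of the Gödel number of `A`. -/
def Fml.quote {k n : ℕ} (A : Fml k) : Tm n := num A.code

/-! The same functions as terms of the language. -/

/-- The term for the pairing function. -/
def pr {n : ℕ} (s t : Tm n) : Tm n := Tm.add (Tm.mul (Tm.add s t) (Tm.add s t)) s

/-- Code of a node with tag `c` and one child. -/
def tag₁ {n : ℕ} (c : ℕ) (t : Tm n) : Tm n := pr (num c) t

/-- Code of a node with tag `c` and two children. -/
def tag₂ {n : ℕ} (c : ℕ) (s t : Tm n) : Tm n := pr (num c) (pr s t)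

/-- Triples. -/
def tr {n : ℕ} (s t u : Tm n) : Tm n := pr s (pr t u)

/-- Quadruples. -/
def qu {n : ℕ} (s t u v : Tm n) : Tm n := pr s (pr t (pr u v))

/-! ### Arithmetization

A formula `P : Fml k` stands for the relation `P(#0, …, #(k-1))`. -/

/-- `#0 ≤ #1`. -/
def leF : Fml 2 := ∃₀ (Tm.add #1 #0 ≐ #2)

/-- `#0 < #1`. -/
def ltF : Fml 2 := ∃₀ (Tm.succ (Tm.add #1 #0) ≐ #2)

/-- Gödel's β-function: `#0` is the remainder of `#1` on division by `1 + (#3 + 1) · #2`. So the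
pair `(#1, #2)` codes a finite sequence of numbers, and its entry number `#3` is `#0`. -/
def betaF : Fml 4 :=
  (∃₀ (#2 ≐ Tm.add (Tm.mul #0 (Tm.succ (Tm.mul (Tm.succ #4) #3))) #1)) ⋏
    leF ⬝ ![#0, Tm.mul (Tm.succ #3) #2]

/-- `#0` is the code `⟨c, ⟨d, n⟩⟩` of a finite sequence, with entries number `0, …, n` given by the
β-function, which ends in `#1` and is a derivation: every entry `y` satisfies `base(y)`, or
`step(y, p, q)` for some earlier entries `p` and `q`. -/
def derivationF (base : Fml 1) (step : Fml 3) : Fml 2 :=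
  -- under the quantifiers `c`, `d`, `n` are `#2`, `#1`, `#0`
  ∃₀ ∃₀ ∃₀ (
    #3 ≐ tr #2 #1 #0 ⋏
    betaF ⬝ ![#4, #2, #1, #0] ⋏
    -- `i` is `#0`
    ∀₀ (leF ⬝ ![#0, #1] ⇒
      -- the entry `y` is `#0`
      ∃₀ (betaF ⬝ ![#0, #4, #3, #1] ⋏
        (base ⬝ ![#0] ⋎
          -- the positions are `#3`, `#2`, the entries `p`, `q` are `#1`, `#0`, and `y` is `#4`
          ∃₀ ∃₀ ∃₀ ∃₀ (ltF ⬝ ![#3, #5] ⋏ ltF ⬝ ![#2, #5] ⋏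
            betaF ⬝ ![#1, #8, #7, #3] ⋏ betaF ⬝ ![#0, #8, #7, #2] ⋏
            step ⬝ ![#4, #1, #0])))))

/-- `#0` has a derivation: it belongs to the least set that contains the numbers with `base(y)` and
contains `y` whenever `step(y, p, q)` for elements `p` and `q`. -/
def derF (base : Fml 1) (step : Fml 3) : Fml 1 :=
  ∃₀ ((derivationF base step) ⬝ ![#0, #1])

/-- `#1` is the Gödel number of the numeral of `#0`. -/
def numeralF : Fml 2 :=
  (derF
    (#0 ≐ pr Tm.zero (tag₁ 1 Tm.zero))
    (∃₀ ∃₀ (#3 ≐ pr #1 #0 ⋏ #2 ≐ pr (Tm.succ #1) (tag₁ 2 #0)))) ⬝ ![pr #0 #1]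

/-- `#1` is the Gödel number of a term with variables among those with index less than `#0`. -/
def termF : Fml 2 :=
  (derF
    -- the number of variables is `#0`
    (∃₀ (#1 ≐ pr #0 (tag₁ 1 Tm.zero) ⋎
      ∃₀ (ltF ⬝ ![#0, #1] ⋏ #2 ≐ pr #1 (tag₁ 0 #0))))
    -- the number of variables is `#2`, the subterms are `#1` and `#0`
    (∃₀ ∃₀ ∃₀ (#4 ≐ pr #2 #1 ⋏ #5 ≐ pr #2 #0 ⋏
      (#3 ≐ pr #2 (tag₁ 2 #1) ⋎
       #3 ≐ pr #2 (tag₂ 3 #1 #0) ⋎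
       #3 ≐ pr #2 (tag₂ 4 #1 #0))))) ⬝ ![pr #0 #1]

/-- `#1` is the Gödel number of a formula with free variables among those with index less than
`#0`. -/
def formulaF : Fml 2 :=
  (derF
    -- the number of variables is `#2`, the terms are `#1` and `#0`
    (∃₀ ∃₀ ∃₀ (termF ⬝ ![#2, #1] ⋏ termF ⬝ ![#2, #0] ⋏
      (#3 ≐ pr #2 (tag₂ 5 #1 #0) ⋎ #3 ≐ pr #2 (tag₁ 6 #1))))
    -- the number of variables is `#2`, the subformulas are `#1` and `#0`
    (∃₀ ∃₀ ∃₀ (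
      (#4 ≐ pr #2 #1 ⋏ #5 ≐ pr #2 #0 ⋏
        (#3 ≐ pr #2 (tag₂ 7 #1 #0) ⋎
         #3 ≐ pr #2 (tag₂ 8 #1 #0) ⋎
         #3 ≐ pr #2 (tag₂ 9 #1 #0))) ⋎
      (#4 ≐ pr (Tm.succ #2) #1 ⋏
        (#3 ≐ pr #2 (tag₁ 10 #1) ⋎
         #3 ≐ pr #2 (tag₁ 11 #1)))))) ⬝ ![pr #0 #1]

/-- `#0` is the Gödel number of a sentence. -/
def sentenceF : Fml 1 := formulaF ⬝ ![Tm.zero, #0]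

/-- `#3` is the Gödel number of the result of putting the closed term with Gödel number `#1` for
the variable with index `#0` in the term or formula with Gödel number `#2`. Since the closed term
stays the same under quantifiers, and is put for a variable which is bound by no quantifier, the
index of the variable grows by one under each quantifier. -/
def substF : Fml 4 :=
  (derF
    -- the index is `#1`, the closed term is `#0`
    (∃₀ ∃₀ (
      #2 ≐ qu #1 #0 (tag₁ 0 #1) #0 ⋎
      #2 ≐ qu #1 #0 (tag₁ 1 Tm.zero) (tag₁ 1 Tm.zero) ⋎
      ∃₀ ((#0 ≐ #2).neg ⋏ #3 ≐ qu #2 #1 (tag₁ 0 #0) (tag₁ 0 #0))))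
    -- the index is `#5`, the closed term is `#4`, and `#3` becomes `#2`, and `#1` becomes `#0`
    (∃₀ ∃₀ ∃₀ ∃₀ ∃₀ ∃₀ (
      (#7 ≐ qu #5 #4 #3 #2 ⋏
        (#6 ≐ qu #5 #4 (tag₁ 2 #3) (tag₁ 2 #2) ⋎
         #6 ≐ qu #5 #4 (tag₁ 6 #3) (tag₁ 6 #2))) ⋎
      (#7 ≐ qu #5 #4 #3 #2 ⋏ #8 ≐ qu #5 #4 #1 #0 ⋏
        (#6 ≐ qu #5 #4 (tag₂ 3 #3 #1) (tag₂ 3 #2 #0) ⋎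
         #6 ≐ qu #5 #4 (tag₂ 4 #3 #1) (tag₂ 4 #2 #0) ⋎
         #6 ≐ qu #5 #4 (tag₂ 5 #3 #1) (tag₂ 5 #2 #0) ⋎
         #6 ≐ qu #5 #4 (tag₂ 7 #3 #1) (tag₂ 7 #2 #0) ⋎
         #6 ≐ qu #5 #4 (tag₂ 8 #3 #1) (tag₂ 8 #2 #0) ⋎
         #6 ≐ qu #5 #4 (tag₂ 9 #3 #1) (tag₂ 9 #2 #0))) ⋎
      (#7 ≐ qu (Tm.succ #5) #4 #3 #2 ⋏
        (#6 ≐ qu #5 #4 (tag₁ 10 #3) (tag₁ 10 #2) ⋎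
         #6 ≐ qu #5 #4 (tag₁ 11 #3) (tag₁ 11 #2)))))) ⬝ ![qu #0 #1 #2 #3]

/-- `#3` is the Gödel number of the result of putting the numeral of `#1` for the variable with
index `#0` in the formula with Gödel number `#2`. -/
def substNumF : Fml 4 := ∃₀ (numeralF ⬝ ![#2, #0] ⋏ substF ⬝ ![#1, #0, #3, #4])

/-- `#1` is the Gödel number of the result of putting the numerals of `#2, …, #(k+1)` for the
variables with index `0, …, k-1` in the formula with Gödel number `#0`. -/
def substNumsF : (k : ℕ) → Fml (k + 2)
  | 0 => #0 ≐ #1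
  | k + 1 =>
    -- the formula in which the last one of the variables has been replaced is `#0`
    ∃₀ (substNumF ⬝ ![num k, #(Fin.last (k + 3)), #1, #0] ⋏
      (substNumsF k) ⬝ (Fin.cases #0 (Fin.cases #2 (fun i => #(i.castSucc.succ.succ.succ)))))

/-! ### The axioms for `□` -/

/-- `□⌜A ∨ B⌝ ↔ □⌜A⌝ ∨ □⌜B⌝` for all sentences `A` and `B`. -/
def boxOr : Fml 0 :=
  ∀₀ ∀₀ (sentenceF ⬝ ![#1] ⋏ sentenceF ⬝ ![#0] ⇒
    (Fml.box (tag₂ 8 #1 #0)).iff (Fml.box #1 ⋎ Fml.box #0))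

/-- `□⌜A ∧ B⌝ ↔ □⌜A⌝ ∧ □⌜B⌝` for all sentences `A` and `B`. -/
def boxAnd : Fml 0 :=
  ∀₀ ∀₀ (sentenceF ⬝ ![#1] ⋏ sentenceF ⬝ ![#0] ⇒
    (Fml.box (tag₂ 7 #1 #0)).iff (Fml.box #1 ⋏ Fml.box #0))

/-- `□⌜(∃ n) A(n)⌝ ← (∃ n) □⌜A(n̄)⌝` for all formulas `A` with at most one free variable. -/
def boxEx : Fml 0 :=
  ∀₀ (formulaF ⬝ ![num 1, #0] ⇒
    ∃₀ ∃₀ (substNumF ⬝ ![Tm.zero, #1, #2, #0] ⋏ Fml.box #0) ⇒ Fml.box (tag₁ 11 #0))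

/-- `□⌜(∀ n) A(n)⌝ ↔ (∀ n) □⌜A(n̄)⌝` for all formulas `A` with at most one free variable. -/
def boxAll : Fml 0 :=
  ∀₀ (formulaF ⬝ ![num 1, #0] ⇒
    (Fml.box (tag₁ 10 #0)).iff
      (∀₀ ∀₀ (substNumF ⬝ ![Tm.zero, #1, #2, #0] ⇒ Fml.box #0)))

/-- `□⌜A → B⌝ → (□⌜A⌝ → □⌜B⌝)` for all sentences `A` and `B`. -/
def boxImp : Fml 0 :=
  ∀₀ ∀₀ (sentenceF ⬝ ![#1] ⋏ sentenceF ⬝ ![#0] ⇒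
    Fml.box (tag₂ 9 #1 #0) ⇒ Fml.box #1 ⇒ Fml.box #0)

/-- The formula `□⌜A(n̄₁, …, n̄ₖ)⌝`, with the same free variables `n₁, …, nₖ` as `A`. -/
def Fml.boxed {k : ℕ} (A : Fml k) : Fml k :=
  ∃₀ ((substNumsF k) ⬝ (Fin.cases A.quote (Fin.cases #0 (fun i => #(Fin.succ i)))) ⋏ Fml.box #0)

/-- The axioms for `□` (to be closed universally); the last one is the scheme of capture. -/
inductive BoxAxiom : {n : ℕ} → Fml n → Prop
  | or : BoxAxiom boxOr
  | and : BoxAxiom boxAnd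
  | ex : BoxAxiom boxEx
  | all : BoxAxiom boxAll
  | imp : BoxAxiom boxImp
  | capture {k : ℕ} (A : Fml k) : BoxAxiom (A ⇒ A.boxed)

/-! ### The system `S_□` -/

/-- The main axioms of `S_□`: the non-logical axioms of `S`, and the universal closures of the
instances of induction, of the logical axiom schemes and of the axioms for `□`, for all formulas of
the language with `□`. -/
def mainAxioms (S : Set (Fml 0)) : Set (Fml 0) :=
  S ∪ {C | ∃ (n : ℕ) (B : Fml n),
    (InductionAxiom B ∨ LogicalAxiom B ∨ BoxAxiom B) ∧ C = alls n B}

/-- The jump axiom `(∀ g)(Ax(g) → □(g))`. -/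
def jump (Ax : Fml 1) : Fml 0 := ∀₀ (Ax ⇒ Fml.box #0)

/-- The theorems of `S_□`. -/
def BoxTheorem (S : Set (Fml 0)) (Ax : Fml 1) (A : Fml 0) : Prop :=
  Derivable (mainAxioms S ∪ {jump Ax}) A

/-- The value of a term in the standard model. -/
def Tm.val {n : ℕ} (e : Fin n → ℕ) : Tm n → ℕ
  | .var i => e i
  | .zero => 0
  | .succ t => t.val e + 1
  | .add s t => s.val e + t.val e
  | .mul s t => s.val e * t.val e

/-- Truth in the standard model of arithmetic, with `X` as the interpretation of `□`; for formulas
of first order arithmetic `X` does not matter. -/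
def Fml.Holds (X : Set ℕ) : {n : ℕ} → (Fin n → ℕ) → Fml n → Prop
  | _, e, .eq s t => s.val e = t.val e
  | _, e, .box t => t.val e ∈ X
  | _, e, .and A B => A.Holds X e ∧ B.Holds X e
  | _, e, .or A B => A.Holds X e ∨ B.Holds X e
  | _, e, .imp A B => A.Holds X e → B.Holds X e
  | _, e, .all A => ∀ a : ℕ, A.Holds X (Fin.cases a e)
  | _, e, .ex A => ∃ a : ℕ, A.Holds X (Fin.cases a e)

/-- `Ax(g)` is a formula of first order arithmetic which expresses that `g` is the Gödel number of a
main axiom of `S_□`, and `Ax(ḡ)` is provable in Peano arithmetic whenever it is true. -/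
structure ExpressesMainAxioms (S : Set (Fml 0)) (Ax : Fml 1) : Prop where
  isArith : Ax.IsArith
  holds_iff : ∀ g : ℕ, Ax.Holds ∅ ![g] ↔ ∃ A ∈ mainAxioms S, A.code = g
  provable : ∀ g : ℕ, Ax.Holds ∅ ![g] → ArithTheorem PA (Ax ⬝ ![num g])

/-! ### Provability and consistency, formalized -/

/-- `#2` is the Gödel number of the formula `(∀ n₁ … nₖ) A`, where `k` is `#0` and `#1` is the Gödel
number of `A`. -/
def allsF : Fml 3 :=
  (derF
    (∃₀ (#1 ≐ tr Tm.zero #0 #0))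
    (∃₀ ∃₀ ∃₀ (#4 ≐ tr #2 #1 #0 ⋏ #3 ≐ tr (Tm.succ #2) #1 (tag₁ 10 #0)))) ⬝ ![tr #0 #1 #2]

/-- For some `k`, `A` and `B`, the numbers `#0`, `#1`, `#2` are the Gödel numbers of
`(∀ n₁ … nₖ) A`, `(∀ n₁ … nₖ)(A → B)` and `(∀ n₁ … nₖ) B`. -/
def modusPonensF : Fml 3 :=
  ∃₀ ∃₀ ∃₀ (allsF ⬝ ![#2, #1, #3] ⋏ allsF ⬝ ![#2, tag₂ 9 #1 #0, #4] ⋏ allsF ⬝ ![#2, #0, #5])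

/-- `#0` is the Gödel number of a proof in `S_□` of the sentence with Gödel number `#1`: a finite
sequence of sentences, each of which is a main axiom, or is the jump axiom, or follows from earlier
ones by modus ponens. -/
def proofF (Ax : Fml 1) : Fml 2 :=
  derivationF
    (sentenceF ⬝ ![#0] ⋏ (Ax ⬝ ![#0] ⋎ #0 ≐ (jump Ax).quote))
    (sentenceF ⬝ ![#0] ⋏ modusPonensF ⬝ ![#1, #2, #0])

/-- `Prov_{S_□}(#0)`: there is a proof in `S_□` of the sentence with Gödel number `#0`. -/
def provF (Ax : Fml 1) : Fml 1 := ∃₀ ((proofF Ax) ⬝ ![#0, #1])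

/-- `Con(S_□)`: no number is the Gödel number of a proof in `S_□` of `0 = 1`. -/
def conF (Ax : Fml 1) : Fml 0 :=
  ∀₀ ((proofF Ax) ⬝ ![#0, (Fml.bot : Fml 0).quote]).neg

end Assertibility

open Assertibility

namespace Assertibility

/-! ### Substitution -/

/-! Reason inside `S_□` by induction along a formalized proof. A main axiom is assertible by the
jump axiom. The jump axiom is itself an axiom, so capture makes it assertible. There remains modus
ponens under `k` quantifiers, which is handled by a second induction, on `k` (`prv_soundMPF`). For
`k = 0` this is the axiom for `→`. For `k + 1`, the axiom for `∀` turns an assertible `∀` into the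
assertibility of all its numerical instances. The instances of the two premises form a modus ponens
under `k` quantifiers, and the axiom for `∀`, read backwards, reassembles the conclusion.

For consistency, `Con` is arithmetical, so excluded middle applies to it. If it holds, capture gives
`□⌜Con⌝`. If it fails, there is a proof of `0 = 1`, so soundness gives `□⌜0 = 1⌝`. Capture of `⊥ →
Con` and the axiom for `→` again give `□⌜Con⌝`.

To avoid writing out Hilbert-style derivations, entailment is tested in saturated prime theories
(`World`), for which a Henkin-style completeness theorem holds (`Ent.of_forall_world`). A world
decides every arithmetical formula, so on these membership is classical truth in a model of PA
(`World.mem_iff_sat`). All arithmetized syntax is thus ordinary mathematics in a possibly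
nonstandard model, where induction is available for definable sets only, and sequences come from the
β-function (`exists_beta`).

A single world is not closed under introduction of `→` and `∀` for formulas with `□`. Statements of
this kind, above all the two inductions, are therefore proved as entailments: quantifiers and
implications are introduced in the calculus, and an arbitrary world is entered only afterwards. -/

theorem Tm.subst_subst {n m k : ℕ} (σ : Fin n → Tm m) (τ : Fin m → Tm k) (t : Tm n) :
    (t.subst σ).subst τ = t.subst (fun i => (σ i).subst τ) := by
  induction t with
  | var i => rfl
  | zero => rfl
  | succ t ih => simp only [Tm.subst, ih]
  | add s t ihs iht => simp only [Tm.subst, ihs, iht]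
  | mul s t ihs iht => simp only [Tm.subst, ihs, iht]

theorem Tm.subst_var {n : ℕ} (t : Tm n) : t.subst Tm.var = t := by
  induction t with
  | var i => rfl
  | zero => rfl
  | succ t ih => simp only [Tm.subst, ih]
  | add s t ihs iht => simp only [Tm.subst, ihs, iht]
  | mul s t ihs iht => simp only [Tm.subst, ihs, iht]

theorem up_var {n : ℕ} : up (Tm.var : Fin n → Tm n) = Tm.var := by
  funext i
  refine Fin.cases rfl (fun j => rfl) i

theorem up_subst {n m k : ℕ} (σ : Fin n → Tm m) (τ : Fin m → Tm k) :
    (fun i => (up σ i).subst (up τ)) = up (fun i => (σ i).subst τ) := by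
  funext i
  refine Fin.cases rfl (fun j => ?_) i
  simp only [up, Fin.cases_succ, Tm.subst_subst, Tm.subst]

theorem Fml.subst_subst {n m k : ℕ} (σ : Fin n → Tm m) (τ : Fin m → Tm k) (A : Fml n) :
    (A.subst σ).subst τ = A.subst (fun i => (σ i).subst τ) := by
  induction A generalizing m k with
  | eq s t => simp only [Fml.subst, Tm.subst_subst]
  | box t => simp only [Fml.subst, Tm.subst_subst]
  | and A B ihA ihB => simp only [Fml.subst, ihA, ihB]
  | or A B ihA ihB => simp only [Fml.subst, ihA, ihB]
  | imp A B ihA ihB => simp only [Fml.subst, ihA, ihB]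
  | all A ih => simp only [Fml.subst, ih, up_subst]
  | ex A ih => simp only [Fml.subst, ih, up_subst]

theorem Fml.subst_var {n : ℕ} (A : Fml n) : A.subst Tm.var = A := by
  induction A with
  | eq s t => simp only [Fml.subst, Tm.subst_var]
  | box t => simp only [Fml.subst, Tm.subst_var]
  | and A B ihA ihB => simp only [Fml.subst, ihA, ihB]
  | or A B ihA ihB => simp only [Fml.subst, ihA, ihB]
  | imp A B ihA ihB => simp only [Fml.subst, ihA, ihB]
  | all A ih => simp only [Fml.subst, up_var, ih]
  | ex A ih => simp only [Fml.subst, up_var, ih]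

@[simp]
theorem Fml.isArith_subst {n m : ℕ} (σ : Fin n → Tm m) (A : Fml n) :
    (A.subst σ).IsArith ↔ A.IsArith := by
  induction A generalizing m with
  | eq s t => rfl
  | box t => rfl
  | and A B ihA ihB => simp only [Fml.subst, Fml.IsArith, ihA, ihB]
  | or A B ihA ihB => simp only [Fml.subst, Fml.IsArith, ihA, ihB]
  | imp A B ihA ihB => simp only [Fml.subst, Fml.IsArith, ihA, ihB]
  | all A ih => simp only [Fml.subst, Fml.IsArith, ih]
  | ex A ih => simp only [Fml.subst, Fml.IsArith, ih]

/-- Substituting under a quantifier and then instantiating. -/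
theorem Fml.subst_up_inst {n m : ℕ} (A : Fml (n + 1)) (σ : Fin n → Tm m) (t : Tm m) :
    (A.subst (up σ)).inst t = A.subst (Fin.cases t σ) := by
  rw [Fml.inst, Fml.subst_subst]
  congr 1
  funext i
  refine Fin.cases rfl (fun j => ?_) i
  simp only [up, Fin.cases_succ, Tm.subst_subst, Tm.subst]
  exact Tm.subst_var _

/-! ### Countability of the language -/

/-- With `s = a + b`, the value `s² + a` lies between `s²` and `(s + 1)²`, so it determines `s`, and
then `a`. -/
theorem npair_inj {a b c d : ℕ} : npair a b = npair c d ↔ a = c ∧ b = d := by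
  constructor
  · intro h
    unfold npair at h
    have h1 : a + b = c + d := by
      rcases lt_trichotomy (a + b) (c + d) with h' | h' | h'
      · nlinarith
      · exact h'
      · nlinarith
    rw [h1] at h
    omega
  · rintro ⟨rfl, rfl⟩
    rfl

theorem Tm.code_injective {n : ℕ} : Function.Injective (Tm.code : Tm n → ℕ) := by
  intro s
  induction s with
  | var i => intro t h; cases t <;> simp_all [Tm.code, npair_inj, Fin.ext_iff]
  | zero => intro t h; cases t <;> simp_all [Tm.code, npair_inj]
  | succ s ih =>
    intro t h
    cases t <;> simp [Tm.code, npair_inj] at h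
    rw [ih h]
  | add s s' ih ih' =>
    intro t h
    cases t <;> simp [Tm.code, npair_inj] at h
    rw [ih h.1, ih' h.2]
  | mul s s' ih ih' =>
    intro t h
    cases t <;> simp [Tm.code, npair_inj] at h
    rw [ih h.1, ih' h.2]

theorem Fml.code_injective {n : ℕ} : Function.Injective (Fml.code : Fml n → ℕ) := by
  intro A
  induction A with
  | eq s t =>
    intro B h
    cases B <;> simp [Fml.code, npair_inj] at h
    rw [Tm.code_injective h.1, Tm.code_injective h.2]
  | box t =>
    intro B h
    cases B <;> simp [Fml.code, npair_inj] at h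
    rw [Tm.code_injective h]
  | and A A' ih ih' =>
    intro B h
    cases B <;> simp [Fml.code, npair_inj] at h
    rw [ih h.1, ih' h.2]
  | or A A' ih ih' =>
    intro B h
    cases B <;> simp [Fml.code, npair_inj] at h
    rw [ih h.1, ih' h.2]
  | imp A A' ih ih' =>
    intro B h
    cases B <;> simp [Fml.code, npair_inj] at h
    rw [ih h.1, ih' h.2]
  | all A ih =>
    intro B h
    cases B <;> simp [Fml.code, npair_inj] at h
    rw [ih h]
  | ex A ih =>
    intro B h
    cases B <;> simp [Fml.code, npair_inj] at h
    rw [ih h]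

/-- Needed so that one sequence of conditions can meet all tasks of the Henkin construction. -/
instance {n : ℕ} : Countable (Fml n) := Fml.code_injective.countable

/-! ### The Hilbert calculus in a context of free variables -/

/-- A set of sentences that contains the universal closures of all logical axioms. -/
class LogicalTheory (Θ : Set (Fml 0)) : Prop where
  mem_of_logical {n : ℕ} {A : Fml n} (h : LogicalAxiom A) : alls n A ∈ Θ

/-- The universal closure of `A` is derivable. -/
def Prv (Θ : Set (Fml 0)) {n : ℕ} (A : Fml n) : Prop := Derivable Θ (alls n A)

/-- `A` follows from the hypothesis `Γ`, all free variables being kept fixed. -/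
def Ent (Θ : Set (Fml 0)) {n : ℕ} (Γ A : Fml n) : Prop := Prv Θ (Γ ⇒ A)

/-- The rule under a block of quantifiers is exactly modus ponens for open formulas read as their
closures. -/
theorem Prv.mp {Θ : Set (Fml 0)} {n : ℕ} {A B : Fml n} (h : Prv Θ (A ⇒ B)) (h' : Prv Θ A) :
    Prv Θ B :=
  Derivable.mp n A B h' h

section

variable {Θ : Set (Fml 0)} [LogicalTheory Θ] {n m : ℕ} {A B C Γ : Fml n}

theorem Prv.logical (h : LogicalAxiom A) : Prv Θ A := .ax (LogicalTheory.mem_of_logical h)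

theorem Prv.ent (h : Prv Θ A) : Ent Θ Γ A := (Prv.logical (.k A Γ)).mp h

theorem Ent.mp (h : Ent Θ Γ (A ⇒ B)) (h' : Ent Θ Γ A) : Ent Θ Γ B :=
  ((Prv.logical (.s Γ A B)).mp h).mp h'

theorem Ent.logical (h : LogicalAxiom A) : Ent Θ Γ A := (Prv.logical h).ent

theorem Ent.refl : Ent Θ A A :=
  ((Prv.logical (.s A (A ⇒ A) A)).mp (Prv.logical (.k A (A ⇒ A)))).mp (Prv.logical (.k A A))

theorem Ent.trans (h : Ent Θ A B) (h' : Ent Θ B C) : Ent Θ A C := Ent.mp (Prv.ent h') h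

theorem Ent.and_left : Ent Θ (A ⋏ B) A := Prv.logical (.andLeft A B)

theorem Ent.and_right : Ent Θ (A ⋏ B) B := Prv.logical (.andRight A B)

theorem Ent.and_intro (h : Ent Θ Γ A) (h' : Ent Θ Γ B) : Ent Θ Γ (A ⋏ B) :=
  ((Ent.logical (.andIntro A B)).mp h).mp h'

theorem Ent.curry (h : Ent Θ (Γ ⋏ A) B) : Ent Θ Γ (A ⇒ B) := by
  have h1 : Ent Θ Γ (A ⇒ Γ ⋏ A) := Prv.logical (.andIntro Γ A)
  have h2 : Ent Θ Γ (A ⇒ (Γ ⋏ A ⇒ B)) := Prv.ent (Prv.ent h)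
  exact ((Ent.logical (.s A (Γ ⋏ A) B)).mp h2).mp h1

theorem Ent.or_elim (hA : Ent Θ (Γ ⋏ A) C) (hB : Ent Θ (Γ ⋏ B) C) (h : Ent Θ Γ (A ⋎ B)) :
    Ent Θ Γ C :=
  (((Ent.logical (.orElim A B C)).mp hA.curry).mp hB.curry).mp h

/-- A block with one quantifier needs no permutation. This case of the generalization schemes
suffices, because `Prv` already closes over the remaining variables. -/
theorem rot_zero (m : ℕ) : rot m 0 = Tm.var := by
  funext i
  unfold rot
  split_ifs with h h'
  · congr 1
    exact Fin.ext h.symm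
  · omega
  · rfl

theorem Ent.all_intro {A : Fml (n + 1)} (h : Ent Θ Γ.weaken A) : Ent Θ Γ (∀₀ A) := by
  have h1 := Prv.logical (Θ := Θ) (.genAll (m := n) 0 Γ A)
  rw [rot_zero, Fml.subst_var] at h1
  exact h1.mp h

theorem Ent.all_elim {A : Fml (n + 1)} (h : Ent Θ Γ (∀₀ A)) (t : Tm n) : Ent Θ Γ (A.inst t) :=
  (Ent.logical (.allElim A t)).mp h

theorem Ent.ex_elim_left {A : Fml (n + 1)} (h : Ent Θ A B.weaken) : Ent Θ (∃₀ A) B := by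
  have h1 := Prv.logical (Θ := Θ) (.genEx (m := n) 0 A B)
  rw [rot_zero, Fml.subst_var] at h1
  exact h1.mp h

/-- Closing over `n + 1` variables is, by definition, closing `∀₀` over `n` variables, so vacuous
generalization is all that is needed. -/
theorem Prv.weaken (h : Prv Θ A) : Prv Θ A.weaken :=
  Prv.mp (A := A) (B := ∀₀ A.weaken) (Ent.all_intro Ent.refl) h

/-- Induction on the number of variables: bind `#0`, substitute for the others, then instantiate
with `σ 0`. A sentence only has to be weakened repeatedly. -/
theorem Prv.subst (h : Prv Θ A) (σ : Fin n → Tm m) : Prv Θ (A.subst σ) := by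
  induction n generalizing m with
  | zero =>
    induction m with
    | zero => rwa [Subsingleton.elim σ Tm.var, Fml.subst_var]
    | succ m ih =>
      have h1 := (ih (fun i => i.elim0)).weaken
      rwa [Fml.weaken, Fml.subst_subst, Subsingleton.elim (fun _ => _) σ] at h1
  | succ n ih =>
    have h1 : Prv Θ (∀₀ A) := h
    have h2 := ih h1 (fun i => σ i.succ)
    have h3 := (Prv.logical (.allElim _ (σ 0))).mp h2
    rw [Fml.subst_up_inst] at h3
    convert h3 using 2
    funext i
    exact Fin.cases rfl (fun _ => rfl) i

theorem Ent.subst (h : Ent Θ Γ A) (σ : Fin n → Tm m) : Ent Θ (Γ.subst σ) (A.subst σ) :=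
  Prv.subst h σ

theorem Ent.ex_intro {A : Fml (n + 1)} (t : Tm n) (h : Ent Θ Γ (A.inst t)) : Ent Θ Γ (∃₀ A) :=
  (Ent.logical (.exIntro A t)).mp h

theorem Ent.ex_elim {A : Fml (n + 1)} (h : Ent Θ (Γ.weaken ⋏ A) B.weaken)
    (h' : Ent Θ Γ (∃₀ A)) : Ent Θ Γ B := by
  have h1 : Ent Θ A (Γ ⇒ B).weaken :=
    Ent.curry ((Ent.and_intro Ent.and_right Ent.and_left).trans h)
  exact (h'.trans (Ent.ex_elim_left h1)).mp Ent.refl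

theorem Ent.eq_congr_update (A : Fml m) (σ : Fin m → Tm n) (i : Fin m) (t : Tm n)
    (h : Ent Θ Γ (σ i ≐ t)) (hA : Ent Θ Γ (A.subst σ)) :
    Ent Θ Γ (A.subst (Function.update σ i t)) := by
  -- Slot `i` is kept open by a fresh variable, so that the equality scheme for one variable
  -- applies.
  let τ : Fin m → Tm (n + 1) := fun k => if k = i then #0 else (σ k).subst (fun j => #(Fin.succ j))
  have key : ∀ s : Tm n, (A.subst τ).inst s = A.subst (Function.update σ i s) := by
    intro s
    rw [Fml.inst, Fml.subst_subst]
    congr 1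
    funext k
    by_cases hk : k = i
    · subst hk
      simp [τ, Tm.subst]
    · simp only [τ, hk, if_false, Tm.subst_subst, Tm.subst, Fin.cases_succ, ne_eq,
        not_false_eq_true, Function.update_of_ne]
      exact Tm.subst_var _
  have h1 := (Ent.logical (Γ := Γ) (Θ := Θ) (.eqSubst (A.subst τ) (σ i) t)).mp h
  rw [key, key, Function.update_eq_self] at h1
  exact h1.mp hA

/-- Equal terms may be substituted for each other. -/
theorem Ent.eq_congr (A : Fml m) (σ τ : Fin m → Tm n) (h : ∀ i, Ent Θ Γ (σ i ≐ τ i))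
    (hA : Ent Θ Γ (A.subst σ)) : Ent Θ Γ (A.subst τ) := by
  have key : ∀ s : Finset (Fin m), Ent Θ Γ (A.subst (fun i => if i ∈ s then τ i else σ i)) := by
    intro s
    induction s using Finset.induction_on with
    | empty => simpa using hA
    | insert i s hi ih =>
      have h1 := Ent.eq_congr_update A _ i (τ i) (by simpa [hi] using h i) ih
      convert h1 using 2
      funext k
      by_cases hk : k = i
      · subst hk; simp
      · simp [hk]
  simpa using key Finset.univ

theorem Ent.eq_symm {s t : Tm n} (h : Ent Θ Γ (s ≐ t)) : Ent Θ Γ (t ≐ s) := by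
  have h1 := Ent.eq_congr (Θ := Θ) (Γ := Γ) (#0 ≐ #1 : Fml 2) ![s, s] ![t, s]
    (by
      intro i
      fin_cases i
      · exact h
      · exact Ent.logical (.eqRefl s))
    (Ent.logical (.eqRefl s))
  exact h1

theorem Ent.eq_trans {s t u : Tm n} (h : Ent Θ Γ (s ≐ t)) (h' : Ent Θ Γ (t ≐ u)) :
    Ent Θ Γ (s ≐ u) := by
  have h1 := Ent.eq_congr (Θ := Θ) (Γ := Γ) (#0 ≐ #1 : Fml 2) ![s, t] ![s, u]
    (by
      intro i
      fin_cases i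
      · exact Ent.logical (.eqRefl s)
      · exact h')
    h
  exact h1

/-- The rule of induction, with a hypothesis. -/
theorem Ent.induction {A : Fml (n + 1)} (hA : Prv Θ (A.inst Tm.zero ⋏ ∀₀ (A ⇒ A.atSucc) ⇒ ∀₀ A))
    (h0 : Ent Θ Γ (A.inst Tm.zero)) (hs : Ent Θ (Γ.weaken ⋏ A) A.atSucc) : Ent Θ Γ (∀₀ A) :=
  hA.ent.mp (h0.and_intro hs.curry.all_intro)

end

theorem Derivable.mono {Γ Δ : Set (Fml 0)} (h : Γ ⊆ Δ) {A : Fml 0} (hA : Derivable Γ A) :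
    Derivable Δ A := by
  induction hA with
  | ax hA => exact .ax (h hA)
  | mp k A B _ _ ih₁ ih₂ => exact .mp k A B ih₁ ih₂

/-! ### Saturated prime theories -/

/-- The operations of arithmetic on a type. -/
class ArithOps (M : Type) where
  zero : M
  succ : M → M
  add : M → M → M
  mul : M → M → M

/-- The value of a term. -/
def Tm.eval {M : Type} [ArithOps M] {n : ℕ} (e : Fin n → M) : Tm n → M
  | .var i => e i
  | .zero => ArithOps.zero
  | .succ t => ArithOps.succ (t.eval e)
  | .add s t => ArithOps.add (s.eval e) (t.eval e)
  | .mul s t => ArithOps.mul (s.eval e) (t.eval e)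

/-- A saturated prime theory: the formulas with parameters in `M` that belong to a set which is
closed under derivability and has the disjunction and the existence property. -/
structure World (Θ : Set (Fml 0)) where
  M : Type
  ops : ArithOps M
  Mem : ∀ {n : ℕ}, Fml n → (Fin n → M) → Prop
  mem_eq {n : ℕ} (s t : Tm n) (e : Fin n → M) : Mem (s ≐ t) e ↔ s.eval e = t.eval e
  mem_and {n : ℕ} (A B : Fml n) (e : Fin n → M) : Mem (A ⋏ B) e ↔ Mem A e ∧ Mem B e
  mem_or {n : ℕ} (A B : Fml n) (e : Fin n → M) : Mem (A ⋎ B) e ↔ Mem A e ∨ Mem B e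
  mem_ex {n : ℕ} (A : Fml (n + 1)) (e : Fin n → M) :
    Mem (∃₀ A) e ↔ ∃ a, Mem A (Matrix.vecCons a e)
  mem_imp {n : ℕ} {A B : Fml n} {e : Fin n → M} : Mem (A ⇒ B) e → Mem A e → Mem B e
  mem_all {n : ℕ} {A : Fml (n + 1)} {e : Fin n → M} :
    Mem (∀₀ A) e → ∀ a, Mem A (Matrix.vecCons a e)
  not_mem_bot {n : ℕ} (e : Fin n → M) : ¬ Mem Fml.bot e
  mem_of_prv {n : ℕ} {A : Fml n} : Prv Θ A → ∀ e, Mem A e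
  mem_subst {n m : ℕ} (A : Fml n) (σ : Fin n → Tm m) (e : Fin m → M) :
    Mem (A.subst σ) e ↔ Mem A (fun i => (σ i).eval e)

attribute [instance] World.ops

/-- The variable `k` in the context of the variables `0, …, N-1`. -/
def emb (N k : ℕ) : Tm N := if h : k < N then #⟨k, h⟩ else Tm.zero

/-- The formula `A(x_{e 0}, x_{e 1}, …)` in the context of the variables `x_0, …, x_{N-1}`. -/
def Fml.inCtx {n : ℕ} (A : Fml n) (N : ℕ) (e : Fin n → ℕ) : Fml N := A.subst (fun i => emb N (e i))

theorem emb_subst {N k : ℕ} (h : k < N) (m : ℕ) (σ : Fin N → Tm m) :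
    (emb N k).subst σ = σ ⟨k, h⟩ := by
  simp [emb, h, Tm.subst]

theorem Fml.inCtx_inCtx {n : ℕ} (A : Fml n) {N N' : ℕ} {e : Fin n → ℕ} (h : ∀ i, e i < N) :
    (A.inCtx N e).inCtx N' Fin.val = A.inCtx N' e := by
  simp only [Fml.inCtx, Fml.subst_subst, emb_subst (h _)]

theorem Fml.inCtx_val {n : ℕ} (A : Fml n) : A.inCtx n Fin.val = A := by
  conv_rhs => rw [← Fml.subst_var A]
  simp [Fml.inCtx, emb]

/-- A finite amount of information (a context and a hypothesis) which does not entail `G`. -/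
structure Cond (Θ : Set (Fml 0)) {n₀ : ℕ} (G : Fml n₀) where
  N : ℕ
  Γ : Fml N
  le : n₀ ≤ N
  not_ent : ¬ Ent Θ Γ (G.inCtx N Fin.val)

/-! ### Extending conditions: the density lemmas of the Henkin construction. -/

namespace Cond

variable {Θ : Set (Fml 0)} [LogicalTheory Θ] {n₀ : ℕ} {G : Fml n₀} {n : ℕ}

/-- `p` decides that `A` holds for the variables `e`. -/
def Forces (p : Cond Θ G) (A : Fml n) (e : Fin n → ℕ) : Prop :=
  (∀ i, e i < p.N) ∧ Ent Θ p.Γ (A.inCtx p.N e)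

/-- A larger condition carries more information: a longer context and a hypothesis that entails the
old one. -/
instance : Preorder (Cond Θ G) where
  le p q := p.N ≤ q.N ∧ Ent Θ q.Γ (p.Γ.inCtx q.N Fin.val)
  le_refl p := ⟨le_rfl, by rw [Fml.inCtx_val]; exact Ent.refl⟩
  le_trans p q r h h' := by
    refine ⟨h.1.trans h'.1, ?_⟩
    have h1 := Ent.subst h.2 (fun i => emb r.N i.val)
    change Ent Θ (q.Γ.inCtx r.N Fin.val) ((p.Γ.inCtx q.N Fin.val).inCtx r.N Fin.val) at h1
    rw [Fml.inCtx_inCtx _ (fun i => i.2.trans_le h.1)] at h1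
    exact h'.2.trans h1

theorem Forces.mono {p q : Cond Θ G} (h : p ≤ q) {A : Fml n} {e : Fin n → ℕ} (hp : p.Forces A e) :
    q.Forces A e := by
  refine ⟨fun i => (hp.1 i).trans_le h.1, ?_⟩
  have h1 := Ent.subst hp.2 (fun i => emb q.N i.val)
  change Ent Θ (p.Γ.inCtx q.N Fin.val) ((A.inCtx p.N e).inCtx q.N Fin.val) at h1
  rw [Fml.inCtx_inCtx _ hp.1] at h1
  exact h.2.trans h1

/-- Adding a hypothesis. -/
theorem exists_le_of_not_ent (p : Cond Θ G) (A : Fml n) (e : Fin n → ℕ) (he : ∀ i, e i < p.N)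
    (h : ¬ Ent Θ (p.Γ ⋏ A.inCtx p.N e) (G.inCtx p.N Fin.val)) : ∃ q, p ≤ q ∧ q.Forces A e :=
  ⟨⟨p.N, p.Γ ⋏ A.inCtx p.N e, p.le, h⟩, ⟨le_rfl, by
    rw [Fml.inCtx_val]; exact Ent.and_left⟩, he, Ent.and_right⟩

/-- If neither disjunct could be added, both would lead to `G`, and `∨`-elimination would give `G`
from `p` already. -/
theorem exists_le_of_or (p : Cond Θ G) (A B : Fml n) (e : Fin n → ℕ) (h : p.Forces (A ⋎ B) e) :
    ∃ q, p ≤ q ∧ (q.Forces A e ∨ q.Forces B e) := by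
  by_cases hA : Ent Θ (p.Γ ⋏ A.inCtx p.N e) (G.inCtx p.N Fin.val)
  · by_cases hB : Ent Θ (p.Γ ⋏ B.inCtx p.N e) (G.inCtx p.N Fin.val)
    · exact absurd (Ent.or_elim hA hB h.2) p.not_ent
    · obtain ⟨q, hq⟩ := p.exists_le_of_not_ent B e h.1 hB
      exact ⟨q, hq.1, Or.inr hq.2⟩
  · obtain ⟨q, hq⟩ := p.exists_le_of_not_ent A e h.1 hA
    exact ⟨q, hq.1, Or.inl hq.2⟩

/-- The witness is the first variable outside the context. If assuming `A` of it led to `G`, then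
`∃`-elimination would give `G` from `p` already. -/
theorem exists_le_of_ex (p : Cond Θ G) (A : Fml (n + 1)) (e : Fin n → ℕ)
    (h : p.Forces (∃₀ A) e) : ∃ q, p ≤ q ∧ ∃ v : ℕ, q.Forces A (Matrix.vecCons v e) := by
  have hb : ∀ i, (Matrix.vecCons p.N e : Fin (n + 1) → ℕ) i < p.N + 1 := by
    intro i
    refine Fin.cases (by simp) (fun j => ?_) i
    simpa using (h.1 j).trans (Nat.lt_succ_self _)
  refine ⟨⟨p.N + 1, p.Γ.inCtx (p.N + 1) Fin.val ⋏ A.inCtx (p.N + 1) (Matrix.vecCons p.N e),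
    p.le.trans (Nat.le_succ _), fun hG => p.not_ent ?_⟩, ⟨Nat.le_succ _, Ent.and_left⟩, p.N, hb,
    Ent.and_right⟩
  -- The new variable has the last index `p.N`, while `∃`-elimination expects it as `#0`; this
  -- renaming moves it there.
  let σ : Fin (p.N + 1) → Tm (p.N + 1) := fun i =>
    if h : i.val < p.N then #⟨i.val + 1, by omega⟩ else #0
  have h1 := Ent.subst hG σ
  have e1 : ∀ {k : ℕ} (B : Fml k) (e' : Fin k → ℕ), (∀ i, e' i < p.N) →
      (B.inCtx (p.N + 1) e').subst σ = (B.inCtx p.N e').weaken := by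
    intro k B e' hk
    simp only [Fml.inCtx, Fml.weaken, Fml.subst_subst]
    congr 1
    funext i
    rw [emb_subst ((hk i).trans (Nat.lt_succ_self _)), emb_subst (hk i)]
    simp [σ, hk i]
  have e2 : (A.inCtx (p.N + 1) (Matrix.vecCons p.N e)).subst σ
      = A.subst (up (fun i => emb p.N (e i))) := by
    simp only [Fml.inCtx, Fml.subst_subst]
    congr 1
    funext i
    rw [emb_subst (hb i)]
    refine Fin.cases (by simp [σ, up]) (fun j => ?_) i
    simp only [Matrix.cons_val_succ, up, Fin.cases_succ]
    rw [emb_subst (h.1 j)]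
    simp [σ, h.1 j]
  change Ent Θ ((p.Γ.inCtx (p.N + 1) Fin.val).subst σ ⋏
    (A.inCtx (p.N + 1) (Matrix.vecCons p.N e)).subst σ) ((G.inCtx (p.N + 1) Fin.val).subst σ) at h1
  rw [e1 _ _ (fun i => i.2), e1 _ _ (fun i => i.2.trans_le p.le), e2, Fml.inCtx_val] at h1
  exact Ent.ex_elim h1 h.2

/-- Lengthening the context is harmless: `emb` sends each additional variable to `0`, which turns an
entailment of `G` back into one in the old context. -/
theorem exists_le_lt (p : Cond Θ G) (k : ℕ) : ∃ q, p ≤ q ∧ k < q.N := by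
  refine ⟨⟨max p.N (k + 1), p.Γ.inCtx _ Fin.val, p.le.trans (le_max_left _ _), fun h => ?_⟩,
    ⟨le_max_left _ _, Ent.refl⟩, Nat.lt_of_succ_le (le_max_right _ _)⟩
  have h1 := Ent.subst h (fun i => emb p.N i.val)
  change Ent Θ ((p.Γ.inCtx _ Fin.val).inCtx p.N Fin.val) ((G.inCtx _ Fin.val).inCtx p.N Fin.val) at h1
  rw [Fml.inCtx_inCtx _ (fun i => i.2.trans_le (le_max_left _ _)),
    Fml.inCtx_inCtx _ (fun i => i.2.trans_le (p.le.trans (le_max_left _ _))), Fml.inCtx_val] at h1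
  exact p.not_ent h1

/-- The conditions to be met by a generic sequence. -/
inductive Task : Type
  | lt (k : ℕ)
  | or (n : ℕ) (A B : Fml n) (e : Fin n → ℕ)
  | ex (n : ℕ) (A : Fml (n + 1)) (e : Fin n → ℕ)

instance : Countable Task := by
  let f : Task → ℕ ⊕ (Σ n : ℕ, Fml n × Fml n × (Fin n → ℕ)) ⊕ (Σ n : ℕ, Fml (n + 1) × (Fin n → ℕ))
    | .lt k => .inl k
    | .or n A B e => .inr (.inl ⟨n, A, B, e⟩)
    | .ex n A e => .inr (.inr ⟨n, A, e⟩)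
  have hf : Function.Injective f := by
    intro a b h
    cases a <;> cases b <;> simp [f] at h
    · rw [h]
    · obtain ⟨rfl, h⟩ := h
      simp at h
      simp [h]
    · obtain ⟨rfl, h⟩ := h
      simp at h
      simp [h]
  exact hf.countable

/-- What it means to meet a task. -/
def Meets (p : Cond Θ G) : Task → Prop
  | .lt k => k < p.N
  -- The premise speaks of any extension, not of `p` itself. So meeting the task once covers
  -- disjunctions that are forced only later in the sequence.
  | .or _ A B e => (∃ q, p ≤ q ∧ q.Forces (A ⋎ B) e) → p.Forces A e ∨ p.Forces B e
  | .ex _ A e => (∃ q, p ≤ q ∧ q.Forces (∃₀ A) e) → ∃ v : ℕ, p.Forces A (Matrix.vecCons v e)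

theorem exists_meets (p : Cond Θ G) (t : Task) : ∃ q, p ≤ q ∧ q.Meets t := by
  cases t with
  | lt k => exact p.exists_le_lt k
  | or n A B e =>
    by_cases h : ∃ q, p ≤ q ∧ q.Forces (A ⋎ B) e
    · obtain ⟨q, hq, h⟩ := h
      obtain ⟨r, hr, h⟩ := q.exists_le_of_or A B e h
      exact ⟨r, hq.trans hr, fun _ => h⟩
    · exact ⟨p, le_rfl, fun h' => absurd h' h⟩
  | ex n A e =>
    by_cases h : ∃ q, p ≤ q ∧ q.Forces (∃₀ A) e
    · obtain ⟨q, hq, h⟩ := h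
      obtain ⟨r, hr, h⟩ := q.exists_le_of_ex A e h
      exact ⟨r, hq.trans hr, fun _ => h⟩
    · exact ⟨p, le_rfl, fun h' => absurd h' h⟩

/-- Rasiowa–Sikorski: there are countably many tasks, and each is met by a cofinal set of
conditions. -/
theorem exists_generic (p : Cond Θ G) :
    ∃ s : ℕ → Cond Θ G, Monotone s ∧ s 0 = p ∧ ∀ t, ∃ k, (s k).Meets t := by
  have := Encodable.ofCountable Task
  let 𝒟 : Task → Order.Cofinal (Cond Θ G) := fun t =>
    ⟨{q | q.Meets t}, fun q => (q.exists_meets t).imp fun r hr => ⟨hr.2, hr.1⟩⟩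
  exact ⟨Order.sequenceOfCofinals p 𝒟, Order.sequenceOfCofinals.monotone p 𝒟, rfl,
    fun t => ⟨_, Order.sequenceOfCofinals.encode_mem p 𝒟 t⟩⟩

end Cond

/-- A generic increasing sequence of conditions. -/
structure Generic (Θ : Set (Fml 0)) [LogicalTheory Θ] {n₀ : ℕ} (G : Fml n₀) where
  seq : ℕ → Cond Θ G
  mono : Monotone seq
  meets : ∀ t, ∃ k, (seq k).Meets t

/-! ### From a generic sequence to a saturated prime theory. -/

namespace Generic

variable {Θ : Set (Fml 0)} [LogicalTheory Θ] {n₀ : ℕ} {G : Fml n₀} (F : Generic Θ G) {n m : ℕ}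

/-- The formulas that are eventually forced. -/
def Thm (A : Fml n) (e : Fin n → ℕ) : Prop := ∃ k, (F.seq k).Forces A e

theorem exists_bound (e : Fin n → ℕ) : ∃ k, ∀ i, e i < (F.seq k).N := by
  obtain ⟨k, hk⟩ := F.meets (.lt (Finset.univ.sup e))
  exact ⟨k, fun i => (Finset.le_sup (f := e) (Finset.mem_univ i)).trans_lt hk⟩

theorem exists_forces_all {ι : Type} [Finite ι] (k₀ : ℕ) (n : ι → ℕ) (A : ∀ i, Fml (n i))
    (e : ∀ i, Fin (n i) → ℕ) (h : ∀ i, F.Thm (A i) (e i)) :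
    ∃ k, k₀ ≤ k ∧ ∀ i, (F.seq k).Forces (A i) (e i) := by
  choose f hf using h
  have := Fintype.ofFinite ι
  refine ⟨max k₀ (Finset.univ.sup f), le_max_left _ _, fun i => (hf i).mono (F.mono ?_)⟩
  exact (Finset.le_sup (f := f) (Finset.mem_univ i)).trans (le_max_right _ _)

theorem thm_of_prv {A : Fml n} (h : Prv Θ A) (e : Fin n → ℕ) : F.Thm A e := by
  obtain ⟨k, hk⟩ := F.exists_bound e
  exact ⟨k, hk, Prv.ent (h.subst _)⟩

theorem thm_imp {A B : Fml n} {e : Fin n → ℕ} (h : F.Thm (A ⇒ B) e) (h' : F.Thm A e) :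
    F.Thm B e := by
  obtain ⟨k, h⟩ := h
  obtain ⟨l, h'⟩ := h'
  have h1 := h.mono (F.mono (le_max_left k l))
  have h2 := h'.mono (F.mono (le_max_right k l))
  exact ⟨max k l, h1.1, Ent.mp h1.2 h2.2⟩

theorem thm_and {A B : Fml n} {e : Fin n → ℕ} : F.Thm (A ⋏ B) e ↔ F.Thm A e ∧ F.Thm B e := by
  constructor
  · exact fun h => ⟨F.thm_imp (F.thm_of_prv Ent.and_left e) h,
      F.thm_imp (F.thm_of_prv Ent.and_right e) h⟩
  · exact fun h => F.thm_imp (F.thm_imp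
      (F.thm_of_prv (Prv.logical (.andIntro A B)) e) h.1) h.2

theorem thm_or {A B : Fml n} {e : Fin n → ℕ} : F.Thm (A ⋎ B) e ↔ F.Thm A e ∨ F.Thm B e := by
  constructor
  · rintro ⟨k, h⟩
    obtain ⟨l, hl⟩ := F.meets (.or n A B e)
    have h1 := hl ⟨F.seq (max k l), F.mono (le_max_right k l), h.mono (F.mono (le_max_left k l))⟩
    exact h1.imp (fun h => ⟨l, h⟩) (fun h => ⟨l, h⟩)
  · rintro (h | h)
    · exact F.thm_imp (F.thm_of_prv (Prv.logical (.orLeft A B)) e) h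
    · exact F.thm_imp (F.thm_of_prv (Prv.logical (.orRight A B)) e) h

theorem Fml.inCtx_cons {n : ℕ} (A : Fml (n + 1)) (N v : ℕ) (e : Fin n → ℕ) :
    A.inCtx N (Matrix.vecCons v e) =
      (A.subst (up (fun i => emb N (e i)))).inst (emb N v) := by
  rw [Fml.subst_up_inst, Fml.inCtx]
  congr 1
  funext i
  exact Fin.cases rfl (fun _ => rfl) i

theorem thm_all {A : Fml (n + 1)} {e : Fin n → ℕ} (h : F.Thm (∀₀ A) e) (v : ℕ) :
    F.Thm A (Matrix.vecCons v e) := by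
  obtain ⟨k, h⟩ := h
  obtain ⟨l, hl⟩ := F.exists_bound (Matrix.vecCons v e : Fin (n + 1) → ℕ)
  have h1 := h.mono (F.mono (le_max_left k l))
  refine ⟨max k l, fun i => (hl i).trans_le (F.mono (le_max_right k l)).1, ?_⟩
  rw [Fml.inCtx_cons]
  exact Ent.all_elim h1.2 _

theorem thm_ex {A : Fml (n + 1)} {e : Fin n → ℕ} :
    F.Thm (∃₀ A) e ↔ ∃ v : ℕ, F.Thm A (Matrix.vecCons v e) := by
  constructor
  · rintro ⟨k, h⟩
    obtain ⟨l, hl⟩ := F.meets (.ex n A e)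
    obtain ⟨v, hv⟩ := hl ⟨F.seq (max k l), F.mono (le_max_right k l),
      h.mono (F.mono (le_max_left k l))⟩
    exact ⟨v, l, hv⟩
  · rintro ⟨v, k, h⟩
    refine ⟨k, fun i => by simpa using h.1 i.succ, ?_⟩
    have h1 := h.2
    rw [Fml.inCtx_cons] at h1
    exact Ent.ex_intro _ h1

theorem not_thm_bot (e : Fin n → ℕ) : ¬ F.Thm Fml.bot e := by
  rintro ⟨k, h⟩
  exact (F.seq k).not_ent (Ent.mp (Ent.logical (.exFalso _)) h.2)

/-- Terms that are equal to variables may be replaced by these variables. -/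
theorem thm_subst (A : Fml n) (σ : Fin n → Tm m) (e : Fin m → ℕ) (b : Fin n → ℕ)
    (h : ∀ i, F.Thm (#0 ≐ (σ i).subst (fun j => #(Fin.succ j))) (Matrix.vecCons (b i) e)) :
    F.Thm (A.subst σ) e ↔ F.Thm A b := by
  have key : ∀ k, (∀ i, (F.seq k).Forces (#0 ≐ (σ i).subst (fun j => #(Fin.succ j)))
      (Matrix.vecCons (b i) e)) → ∀ i, Ent Θ (F.seq k).Γ
      (emb (F.seq k).N (b i) ≐ (σ i).subst (fun j => emb (F.seq k).N (e j))) := by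
    intro k hk i
    have h1 := (hk i).2
    simp only [Fml.inCtx, Fml.subst, Tm.subst_subst, Tm.subst] at h1
    exact h1
  constructor
  · rintro ⟨k, hA⟩
    obtain ⟨l, hl⟩ := F.exists_bound b
    obtain ⟨r, hr, hf⟩ := F.exists_forces_all (max k l) _ _ _ h
    refine ⟨r, fun i => (hl i).trans_le (F.mono ((le_max_right k l).trans hr)).1, ?_⟩
    have h2 := (hA.mono (F.mono ((le_max_left k l).trans hr))).2
    rw [Fml.inCtx, Fml.subst_subst] at h2
    exact Ent.eq_congr A _ _ (fun i => (key r hf i).eq_symm) h2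
  · rintro ⟨k, hA⟩
    obtain ⟨l, hl⟩ := F.exists_bound e
    obtain ⟨r, hr, hf⟩ := F.exists_forces_all (max k l) _ _ _ h
    refine ⟨r, fun i => (hl i).trans_le (F.mono ((le_max_right k l).trans hr)).1, ?_⟩
    have h2 := (hA.mono (F.mono ((le_max_left k l).trans hr))).2
    rw [Fml.inCtx, Fml.subst_subst]
    exact Ent.eq_congr A _ _ (key r hf) h2

/-- Equality of variables. -/
def setoid : Setoid ℕ where
  r i j := F.Thm (#0 ≐ #1 : Fml 2) ![i, j]
  iseqv := by
    have hr : ∀ i, F.Thm (#0 ≐ #1 : Fml 2) ![i, i] := fun i => by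
      obtain ⟨k, hk⟩ := F.exists_bound (![i, i] : Fin 2 → ℕ)
      exact ⟨k, hk, Ent.logical (.eqRefl _)⟩
    refine ⟨hr, ?_, ?_⟩
    · rintro i j ⟨k, h⟩
      refine ⟨k, fun l => ?_, h.2.eq_symm⟩
      have h0 := h.1 0
      have h1 := h.1 1
      fin_cases l
      · exact h1
      · exact h0
    · rintro i j l ⟨k, h⟩ ⟨k', h'⟩
      have h1 := h.mono (F.mono (le_max_left k k'))
      have h2 := h'.mono (F.mono (le_max_right k k'))
      refine ⟨max k k', fun r => ?_, h1.2.eq_trans h2.2⟩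
      have h0 := h1.1 0
      have h3 := h2.1 1
      fin_cases r
      · exact h0
      · exact h3

/-- The variables up to equality. -/
abbrev Dom : Type := Quotient F.setoid

theorem mk_eq {i j : ℕ} : (⟦i⟧ : F.Dom) = ⟦j⟧ ↔ F.Thm (#0 ≐ #1 : Fml 2) ![i, j] := Quotient.eq

/-- The case of the identity substitution in `thm_subst`. -/
theorem thm_congr (A : Fml n) {e e' : Fin n → ℕ} (h : ∀ i, (⟦e i⟧ : F.Dom) = ⟦e' i⟧) :
    F.Thm A e ↔ F.Thm A e' := by
  have h1 := F.thm_subst A Tm.var e' e (fun i => by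
    have := (F.thm_subst (#0 ≐ #1 : Fml 2) ![#0, #(i.succ)] (Matrix.vecCons (e i) e') ![e i, e' i]
      (fun j => ?_)).2 (F.mk_eq.1 (h i))
    · exact this
    · obtain ⟨k, hk⟩ := F.exists_bound (Matrix.vecCons (![e i, e' i] j) (Matrix.vecCons (e i) e'))
      refine ⟨k, hk, ?_⟩
      fin_cases j
      · exact Ent.logical (.eqRefl _)
      · exact Ent.logical (.eqRefl _))
  rw [Fml.subst_var] at h1
  exact h1.symm

/-- `∃ x, x = t` is provable, and the existence property turns it into a variable equal to `t`. -/
theorem exists_eval (t : Tm n) (e : Fin n → ℕ) :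
    ∃ v : ℕ, F.Thm (#0 ≐ t.subst (fun j => #(Fin.succ j))) (Matrix.vecCons v e) := by
  rw [← thm_ex]
  apply F.thm_of_prv
  apply (Prv.logical (.exIntro _ t)).mp
  rw [Fml.inst, Fml.subst, Tm.subst_subst]
  simp only [Tm.subst, Fin.cases_zero, Fin.cases_succ, Tm.subst_var]
  exact Prv.logical (.eqRefl t)

/-- The value of a term, up to equality. -/
noncomputable def value (t : Tm n) (e : Fin n → F.Dom) : F.Dom :=
  ⟦(F.exists_eval t (fun i => (e i).out)).choose⟧

/-- Makes `value` independent of the chosen representatives and of the chosen witness, since any two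
variables equal to `t` are equal to each other. -/
theorem value_eq_iff (t : Tm n) (e : Fin n → ℕ) (v : ℕ) :
    F.value t (fun i => ⟦e i⟧) = ⟦v⟧ ↔
      F.Thm (#0 ≐ t.subst (fun j => #(Fin.succ j))) (Matrix.vecCons v e) := by
  set w := (F.exists_eval t (fun i => (⟦e i⟧ : F.Dom).out)).choose with hw
  have h1 := (F.exists_eval t (fun i => (⟦e i⟧ : F.Dom).out)).choose_spec
  rw [← hw] at h1
  have h2 : F.Thm (#0 ≐ t.subst (fun j => #(Fin.succ j))) (Matrix.vecCons w e) := by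
    refine (F.thm_congr _ (fun i => ?_)).1 h1
    refine Fin.cases rfl (fun j => ?_) i
    simp
  change (⟦w⟧ : F.Dom) = ⟦v⟧ ↔ _
  constructor
  · intro h
    refine (F.thm_congr _ (fun i => ?_)).1 h2
    refine Fin.cases h (fun j => rfl) i
  · intro h
    rw [F.mk_eq]
    obtain ⟨k, h⟩ := h
    obtain ⟨k', h'⟩ := h2
    have h3 := h.mono (F.mono (le_max_left k k'))
    have h4 := h'.mono (F.mono (le_max_right k k'))
    refine ⟨max k k', fun i => ?_, ?_⟩
    · fin_cases i
      · exact h4.1 0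
      · exact h3.1 0
    · have h5 := h3.2
      have h6 := h4.2
      simp only [Fml.inCtx, Fml.subst, Tm.subst_subst, Tm.subst] at h5 h6
      exact Ent.eq_trans h6 h5.eq_symm

noncomputable instance ops : ArithOps F.Dom where
  zero := F.value Tm.zero ![]
  succ a := F.value (Tm.succ #0) ![a]
  add a b := F.value (Tm.add #0 #1) ![a, b]
  mul a b := F.value (Tm.mul #0 #1) ![a, b]

theorem exists_rep (e : Fin n → F.Dom) : ∃ e' : Fin n → ℕ, (fun i => (⟦e' i⟧ : F.Dom)) = e :=
  ⟨fun i => (e i).out, by simp⟩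

theorem value_subst (t : Tm n) (σ : Fin n → Tm m) (e : Fin m → F.Dom) :
    F.value (t.subst σ) e = F.value t (fun i => F.value (σ i) e) := by
  obtain ⟨e, rfl⟩ := F.exists_rep e
  obtain ⟨b, hb⟩ := F.exists_rep (fun i => F.value (σ i) (fun j => ⟦e j⟧))
  obtain ⟨v, hv⟩ := Quotient.exists_rep (F.value t (fun i => ⟦b i⟧))
  rw [← hb, ← hv, F.value_eq_iff]
  have h1 := (F.value_eq_iff t b v).1 hv.symm
  have h := (F.thm_subst (#0 ≐ t.subst (fun j => #(Fin.succ j))) (up σ) (Matrix.vecCons v e)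
    (Matrix.vecCons v b) (fun i => ?_)).2 h1
  · simpa only [Fml.subst, Tm.subst_subst, Tm.subst, up, Fin.cases_zero, Fin.cases_succ] using h
  · refine Fin.cases ?_ (fun j => ?_) i
    · obtain ⟨k, hk⟩ := F.exists_bound (Matrix.vecCons v (Matrix.vecCons v e))
      exact ⟨k, hk, Ent.logical (.eqRefl _)⟩
    · have h2 := (F.value_eq_iff (σ j) e (b j)).1 (congrFun hb j).symm
      simp only [up, Fin.cases_succ, Matrix.cons_val_succ]
      obtain ⟨k, h2⟩ := h2
      obtain ⟨l, hl⟩ := F.exists_bound (Matrix.vecCons (b j) (Matrix.vecCons v e))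
      refine ⟨max k l, fun i => (hl i).trans_le (F.mono (le_max_right k l)).1, ?_⟩
      have h3 := (h2.mono (F.mono (le_max_left k l))).2
      simp only [Fml.inCtx, Fml.subst, Tm.subst_subst, Tm.subst, Matrix.cons_val_succ] at h3 ⊢
      exact h3

theorem value_var (i : Fin n) (e : Fin n → F.Dom) : F.value #i e = e i := by
  obtain ⟨e, rfl⟩ := F.exists_rep e
  rw [F.value_eq_iff]
  obtain ⟨k, hk⟩ := F.exists_bound (Matrix.vecCons (e i) e)
  exact ⟨k, hk, Ent.logical (.eqRefl _)⟩

/-- `value_subst` reduces a compound term to a one-symbol term at the values of its parts, and the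
operations in `ops` are defined by just those one-symbol terms. -/
theorem value_eq_eval (t : Tm n) (e : Fin n → F.Dom) : F.value t e = t.eval e := by
  induction t with
  | var i => exact F.value_var i e
  | zero =>
    have h := F.value_subst Tm.zero (fun i => i.elim0) e
    rw [Subsingleton.elim (fun _ => _) (![] : Fin 0 → F.Dom)] at h
    exact h
  | succ t ih =>
    have h := F.value_subst (Tm.succ #0) ![t] e
    rw [show (fun i => F.value (![t] i) e) = ![t.eval e] from
      funext fun i => by fin_cases i; exact ih] at h
    exact h
  | add s t ihs iht =>
    have h := F.value_subst (Tm.add #0 #1) ![s, t] e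
    rw [show (fun i => F.value (![s, t] i) e) = ![s.eval e, t.eval e] from
      funext fun i => by fin_cases i; exacts [ihs, iht]] at h
    exact h
  | mul s t ihs iht =>
    have h := F.value_subst (Tm.mul #0 #1) ![s, t] e
    rw [show (fun i => F.value (![s, t] i) e) = ![s.eval e, t.eval e] from
      funext fun i => by fin_cases i; exacts [ihs, iht]] at h
    exact h

/-- Membership of a formula with parameters in the domain. -/
def Holds (A : Fml n) (e : Fin n → F.Dom) : Prop := F.Thm A (fun i => (e i).out)

theorem holds_mk (A : Fml n) (e : Fin n → ℕ) : F.Holds A (fun i => ⟦e i⟧) ↔ F.Thm A e :=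
  F.thm_congr A (fun i => by simp)

theorem holds_cons (A : Fml (n + 1)) (v : ℕ) (e : Fin n → F.Dom) :
    F.Holds A (Matrix.vecCons ⟦v⟧ e) ↔ F.Thm A (Matrix.vecCons v (fun i => (e i).out)) :=
  F.thm_congr A (fun i => by refine Fin.cases (by simp) (fun j => by simp) i)

theorem holds_subst (A : Fml n) (σ : Fin n → Tm m) (e : Fin m → F.Dom) :
    F.Holds (A.subst σ) e ↔ F.Holds A (fun i => (σ i).eval e) := by
  obtain ⟨e, rfl⟩ := F.exists_rep e
  obtain ⟨b, hb⟩ := F.exists_rep (fun i => F.value (σ i) (fun j => ⟦e j⟧))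
  simp only [← F.value_eq_eval]
  rw [← hb, holds_mk, holds_mk]
  exact F.thm_subst A σ e b (fun i => (F.value_eq_iff _ _ _).1 (congrFun hb i).symm)

theorem holds_eq (s t : Tm n) (e : Fin n → F.Dom) :
    F.Holds (s ≐ t) e ↔ s.eval e = t.eval e := by
  have h := F.holds_subst (#0 ≐ #1 : Fml 2) ![s, t] e
  refine Iff.trans h ?_
  obtain ⟨a, ha⟩ := Quotient.exists_rep (s.eval e)
  obtain ⟨b, hb⟩ := Quotient.exists_rep (t.eval e)
  rw [← ha, ← hb, F.mk_eq, ← holds_mk]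
  rw [show (fun i => (![s, t] i).eval e) = fun i => (⟦![a, b] i⟧ : F.Dom) from
      funext fun i => by fin_cases i; exacts [ha.symm, hb.symm]]

/-- The saturated prime theory given by a generic sequence. -/
noncomputable def world : World Θ where
  M := F.Dom
  ops := F.ops
  Mem := F.Holds
  mem_eq := F.holds_eq
  mem_and _ _ _ := F.thm_and
  mem_or _ _ _ := F.thm_or
  mem_ex A e := by
    refine F.thm_ex.trans ⟨fun ⟨v, h⟩ => ⟨⟦v⟧, (F.holds_cons A v e).2 h⟩, fun ⟨a, h⟩ => ?_⟩
    obtain ⟨v, rfl⟩ := Quotient.exists_rep a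
    exact ⟨v, (F.holds_cons A v e).1 h⟩
  mem_imp := F.thm_imp
  mem_all {n A e} h a := by
    obtain ⟨v, rfl⟩ := Quotient.exists_rep a
    exact (F.holds_cons A v e).2 (F.thm_all h v)
  not_mem_bot _ := F.not_thm_bot _
  mem_of_prv h _ := F.thm_of_prv h _
  mem_subst := F.holds_subst

end Generic

/-- Completeness with respect to saturated prime theories. -/
theorem Ent.of_forall_world {Θ : Set (Fml 0)} [LogicalTheory Θ] {n : ℕ} {Γ A : Fml n}
    (h : ∀ (W : World Θ) (e : Fin n → W.M), W.Mem Γ e → W.Mem A e) : Ent Θ Γ A := by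
  by_contra hn
  -- The sequence starts from `Γ` in its own context. No condition in it entails `A`, so `A` is
  -- never forced.
  let p : Cond Θ A := ⟨n, Γ, le_rfl, by rwa [Fml.inCtx_val]⟩
  obtain ⟨s, hs, h0, hm⟩ := p.exists_generic
  let F : Generic Θ A := ⟨s, hs, hm⟩
  have h1 : F.Thm Γ Fin.val := ⟨0, by
    change (s 0).Forces Γ Fin.val
    rw [h0]
    refine ⟨fun i => i.2, ?_⟩
    rw [Fml.inCtx_val]
    exact Ent.refl⟩
  have h2 := h F.world (fun i => ⟦i.val⟧) ((F.holds_mk Γ _).2 h1)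
  obtain ⟨k, h3⟩ := (F.holds_mk A _).1 h2
  exact (s k).not_ent h3.2

/-! ### Models of Peano arithmetic -/

/-- Classical truth in a structure for the language of arithmetic; atoms `□ t` count as true. -/
def Fml.Sat {M : Type} [ArithOps M] : {n : ℕ} → (Fin n → M) → Fml n → Prop
  | _, e, .eq s t => s.eval e = t.eval e
  | _, _, .box _ => True
  | _, e, .and A B => A.Sat e ∧ B.Sat e
  | _, e, .or A B => A.Sat e ∨ B.Sat e
  | _, e, .imp A B => A.Sat e → B.Sat e
  | _, e, .all A => ∀ a : M, A.Sat (Matrix.vecCons a e)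
  | _, e, .ex A => ∃ a : M, A.Sat (Matrix.vecCons a e)

/-- Replaces the atoms `□ t` by a true equation. -/
def Fml.unbox : {n : ℕ} → Fml n → Fml n
  | _, .eq s t => .eq s t
  | _, .box t => .eq t t
  | _, .and A B => .and A.unbox B.unbox
  | _, .or A B => .or A.unbox B.unbox
  | _, .imp A B => .imp A.unbox B.unbox
  | _, .all A => .all A.unbox
  | _, .ex A => .ex A.unbox

theorem Fml.isArith_unbox {n : ℕ} (A : Fml n) : A.unbox.IsArith := by
  induction A with
  | eq | box => trivial
  | and A B ihA ihB | or A B ihA ihB | imp A B ihA ihB => exact ⟨ihA, ihB⟩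
  | all A ih | ex A ih => exact ih

/-- Lets induction in `PAModel` be stated for all formulas, although PA has it only for arithmetical
ones: each formula has the same truth set as an arithmetical formula. -/
theorem Fml.sat_unbox {M : Type} [ArithOps M] {n : ℕ} (A : Fml n) (e : Fin n → M) :
    A.unbox.Sat e ↔ A.Sat e := by
  induction A with
  | eq => rfl
  | box => exact ⟨fun _ => trivial, fun _ => rfl⟩
  | and A B ihA ihB | or A B ihA ihB | imp A B ihA ihB => simp only [Fml.unbox, Fml.Sat, ihA, ihB]
  | all A ih | ex A ih => simp only [Fml.unbox, Fml.Sat, ih]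

theorem Tm.eval_subst {M : Type} [ArithOps M] {n m : ℕ} (t : Tm n) (σ : Fin n → Tm m)
    (e : Fin m → M) : (t.subst σ).eval e = t.eval (fun i => (σ i).eval e) := by
  induction t with
  | var | zero => rfl
  | succ t ih => simp only [Tm.subst, Tm.eval, ih]
  | add s t ihs iht | mul s t ihs iht => simp only [Tm.subst, Tm.eval, ihs, iht]

theorem eval_up {M : Type} [ArithOps M] {n m : ℕ} (σ : Fin n → Tm m) (e : Fin m → M) (a : M) :
    (fun i => (up σ i).eval (Matrix.vecCons a e)) =
      Matrix.vecCons a (fun i => (σ i).eval e) := by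
  funext i
  refine Fin.cases rfl (fun j => ?_) i
  simp only [up, Fin.cases_succ, Tm.eval_subst, Tm.eval, Matrix.cons_val_succ]

theorem Fml.sat_subst {M : Type} [ArithOps M] {n m : ℕ} (A : Fml n) (σ : Fin n → Tm m)
    (e : Fin m → M) : (A.subst σ).Sat e ↔ A.Sat (fun i => (σ i).eval e) := by
  induction A generalizing m with
  | eq s t => simp only [Fml.subst, Fml.Sat, Tm.eval_subst]
  | box => rfl
  | and A B ihA ihB | or A B ihA ihB | imp A B ihA ihB => simp only [Fml.subst, Fml.Sat, ihA, ihB]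
  | all A ih | ex A ih => simp only [Fml.subst, Fml.Sat, ih, eval_up]

/-- Classical models of Peano arithmetic. -/
class PAModel (M : Type) extends ArithOps M where
  succ_ne_zero (a : M) : succ a ≠ zero
  succ_inj {a b : M} : succ a = succ b → a = b
  add_zero (a : M) : add a zero = a
  add_succ (a b : M) : add a (succ b) = succ (add a b)
  mul_zero (a : M) : mul a zero = zero
  mul_succ (a b : M) : mul a (succ b) = add (mul a b) a
  induction {n : ℕ} (A : Fml (n + 1)) (e : Fin n → M) : A.Sat (Matrix.vecCons zero e) →
    (∀ a, A.Sat (Matrix.vecCons a e) → A.Sat (Matrix.vecCons (succ a) e)) →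
    ∀ a, A.Sat (Matrix.vecCons a e)

/-- The theories in the language with `□` that contain Peano arithmetic and full induction. -/
class PATheory (Θ : Set (Fml 0)) : Prop extends LogicalTheory Θ where
  prv_of_paAxiom {n : ℕ} {A : Fml n} (h : PAAxiom A) : Prv Θ A
  prv_of_induction {n : ℕ} {A : Fml n} (h : InductionAxiom A) : Prv Θ A

namespace World

section

variable {Θ : Set (Fml 0)} (W : World Θ) {n : ℕ}

theorem mem_weaken (A : Fml n) (a : W.M) (e : Fin n → W.M) :
    W.Mem A.weaken (Matrix.vecCons a e) ↔ W.Mem A e := W.mem_subst _ _ _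

theorem not_mem_of_mem_neg {A : Fml n} {e : Fin n → W.M} (h : W.Mem A.neg e) : ¬ W.Mem A e :=
  fun h' => W.not_mem_bot e (W.mem_imp h h')

end

variable {Θ : Set (Fml 0)} [PATheory Θ] (W : World Θ) {n : ℕ}

/-- Excluded middle is in the world, and the world is prime. -/
theorem mem_em {A : Fml n} (hA : A.IsArith) (e : Fin n → W.M) : W.Mem A e ∨ W.Mem A.neg e :=
  (W.mem_or _ _ _).1 (W.mem_of_prv (PATheory.prv_of_paAxiom (.em A hA)) e)

theorem ent_imp_of_neg (A B : Fml n) : Ent Θ A.neg (A ⇒ B) := by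
  refine Ent.curry (Ent.of_forall_world fun W e h => ?_)
  obtain ⟨h1, h2⟩ := (W.mem_and _ _ _).1 h
  exact absurd h2 (W.not_mem_of_mem_neg h1)

theorem ent_all_of_neg_ex_neg {A : Fml (n + 1)} (hA : A.IsArith) :
    Ent Θ (∃₀ A.neg).neg (∀₀ A) := by
  refine Ent.all_intro (Ent.of_forall_world fun W e h => ?_)
  rcases W.mem_em hA e with h1 | h1
  · exact h1
  · obtain ⟨a, e, rfl⟩ : ∃ a e', e = Matrix.vecCons a e' := ⟨_, _, (Matrix.cons_head_tail e).symm⟩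
    rw [mem_weaken] at h
    exact absurd ((W.mem_ex _ _).2 ⟨a, h1⟩) (W.not_mem_of_mem_neg h)

/-- The bridge to classical semantics. For `→` and `∀`, where a world gives only elimination, the
missing direction decides `A` or `∃ ¬A` by excluded middle. The negative answers are used through
`¬A ⊢ A → B` and `¬∃¬A ⊢ ∀A`. -/
theorem mem_iff_sat {A : Fml n} (hA : A.IsArith) (e : Fin n → W.M) : W.Mem A e ↔ A.Sat e := by
  induction A with
  | eq s t => exact W.mem_eq s t e
  | box t => exact hA.elim
  | and A B ihA ihB => rw [W.mem_and, ihA hA.1, ihB hA.2]; rfl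
  | or A B ihA ihB => rw [W.mem_or, ihA hA.1, ihB hA.2]; rfl
  | imp A B ihA ihB =>
    simp only [Fml.Sat]
    rw [← ihA hA.1, ← ihB hA.2]
    refine ⟨W.mem_imp, fun h => ?_⟩
    rcases W.mem_em hA.1 e with h1 | h1
    · exact W.mem_imp (W.mem_of_prv (Prv.logical (.k B A)) e) (h h1)
    · exact W.mem_imp (W.mem_of_prv (ent_imp_of_neg A B) e) h1
  | ex A ih => simp only [W.mem_ex, Fml.Sat, ih hA]
  | all A ih =>
    simp only [Fml.Sat, ← ih hA]
    refine ⟨W.mem_all, fun h => ?_⟩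
    rcases W.mem_em (A := ∃₀ A.neg) ⟨hA, trivial⟩ e with h1 | h1
    · obtain ⟨a, ha⟩ := (W.mem_ex _ _).1 h1
      exact absurd (h a) (W.not_mem_of_mem_neg ha)
    · exact W.mem_imp (W.mem_of_prv (ent_all_of_neg_ex_neg hA) e) h1

theorem sat_of_paAxiom {A : Fml n} (h : PAAxiom A) (hA : A.IsArith) (e : Fin n → W.M) : A.Sat e :=
  (W.mem_iff_sat hA e).1 (W.mem_of_prv (PATheory.prv_of_paAxiom h) e)

instance : PAModel W.M where
  succ_ne_zero a h := W.not_mem_bot ![a] ((W.mem_iff_sat (A := (Fml.bot : Fml 1))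
    (by simp [Fml.IsArith, Fml.bot]) _).2
    (W.sat_of_paAxiom (n := 1) (.succNeZero #0) (by simp [Fml.IsArith, Fml.neg, Fml.bot])
      ![a] h))
  succ_inj {a b} h := W.sat_of_paAxiom (n := 2) (.succInj #0 #1) (by simp [Fml.IsArith]) ![a, b] h
  add_zero a := by
    simpa [Fml.Sat, Tm.eval] using
      W.sat_of_paAxiom (n := 1) (.addZero #0) (by simp [Fml.IsArith]) ![a]
  add_succ a b := by
    simpa [Fml.Sat, Tm.eval] using
      W.sat_of_paAxiom (n := 2) (.addSucc #0 #1) (by simp [Fml.IsArith]) ![a, b]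
  mul_zero a := by
    simpa [Fml.Sat, Tm.eval] using
      W.sat_of_paAxiom (n := 1) (.mulZero #0) (by simp [Fml.IsArith]) ![a]
  mul_succ a b := by
    simpa [Fml.Sat, Tm.eval] using
      W.sat_of_paAxiom (n := 2) (.mulSucc #0 #1) (by simp [Fml.IsArith]) ![a, b]
  induction {n} A e h0 hs := by
    have h := W.sat_of_paAxiom (.induction _ (by
      simp [Fml.IsArith, Fml.inst, Fml.atSucc, Fml.isArith_unbox]) (.mk A.unbox)) (by
      simp [Fml.IsArith, Fml.inst, Fml.atSucc, Fml.isArith_unbox]) e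
    simp only [Fml.Sat, Fml.inst, Fml.atSucc, Fml.sat_subst, Fml.sat_unbox] at h
    refine h ⟨?_, fun a ha => ?_⟩
    · convert h0 using 2
      rename_i i
      exact Fin.cases rfl (fun _ => rfl) i
    · convert hs a ha using 2
      rename_i i
      exact Fin.cases rfl (fun _ => rfl) i

end World

/-! ### Arithmetic in a model -/

section Model

variable {M : Type} [PAModel M]

/-- Sets that are definable with parameters. -/
def Definable (P : M → Prop) : Prop :=
  ∃ (n : ℕ) (A : Fml (n + 1)) (e : Fin n → M), ∀ a, P a ↔ A.Sat (Matrix.vecCons a e)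

namespace PAModel

theorem induct {n : ℕ} (A : Fml (n + 1)) (e : Fin n → M) {P : M → Prop}
    (hP : ∀ a, P a ↔ A.Sat (Matrix.vecCons a e)) (h0 : P ArithOps.zero)
    (hs : ∀ a, P a → P (ArithOps.succ a)) (a : M) : P a :=
  (hP a).2 (PAModel.induction A e ((hP _).1 h0) (fun a ha => (hP _).1 (hs a ((hP a).2 ha))) a)

open ArithOps

theorem zero_add (a : M) : add zero a = a := by
  refine induct (Tm.add Tm.zero #0 ≐ #0) ![] (P := fun a => add zero a = a) (fun _ => Iff.rfl)
    (add_zero _) (fun a h => ?_) a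
  rw [add_succ, h]

theorem succ_add (a b : M) : add (succ a) b = succ (add a b) := by
  refine induct (Tm.add (Tm.succ #1) #0 ≐ Tm.succ (Tm.add #1 #0)) ![a]
    (P := fun b => add (succ a) b = succ (add a b)) (fun _ => Iff.rfl) ?_ (fun b h => ?_) b
  · rw [add_zero, add_zero]
  · rw [add_succ, h, add_succ]

theorem add_comm (a b : M) : add a b = add b a := by
  refine induct (Tm.add #1 #0 ≐ Tm.add #0 #1) ![a]
    (P := fun b => add a b = add b a) (fun _ => Iff.rfl) ?_ (fun b h => ?_) b
  · rw [add_zero, zero_add]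
  · rw [add_succ, h, succ_add]

theorem add_assoc (a b c : M) : add (add a b) c = add a (add b c) := by
  refine induct (Tm.add (Tm.add #1 #2) #0 ≐ Tm.add #1 (Tm.add #2 #0)) ![a, b]
    (P := fun c => add (add a b) c = add a (add b c)) (fun _ => Iff.rfl) ?_ (fun c h => ?_) c
  · rw [add_zero, add_zero]
  · rw [add_succ, h, add_succ, add_succ]

theorem zero_mul (a : M) : mul zero a = zero := by
  refine induct (Tm.mul Tm.zero #0 ≐ Tm.zero) ![] (P := fun a => mul zero a = zero)
    (fun _ => Iff.rfl) (mul_zero _) (fun a h => ?_) a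
  rw [mul_succ, h, add_zero]

theorem succ_mul (a b : M) : mul (succ a) b = add (mul a b) b := by
  refine induct (Tm.mul (Tm.succ #1) #0 ≐ Tm.add (Tm.mul #1 #0) #0) ![a]
    (P := fun b => mul (succ a) b = add (mul a b) b) (fun _ => Iff.rfl) ?_ (fun b h => ?_) b
  · rw [mul_zero, mul_zero, add_zero]
  · rw [mul_succ, h, mul_succ, add_succ, add_succ, add_assoc, add_comm b a, ← add_assoc]

theorem mul_comm (a b : M) : mul a b = mul b a := by
  refine induct (Tm.mul #1 #0 ≐ Tm.mul #0 #1) ![a]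
    (P := fun b => mul a b = mul b a) (fun _ => Iff.rfl) ?_ (fun b h => ?_) b
  · rw [mul_zero, zero_mul]
  · rw [mul_succ, h, succ_mul]

theorem mul_add (a b c : M) : mul a (add b c) = add (mul a b) (mul a c) := by
  refine induct (Tm.mul #1 (Tm.add #2 #0) ≐ Tm.add (Tm.mul #1 #2) (Tm.mul #1 #0)) ![a, b]
    (P := fun c => mul a (add b c) = add (mul a b) (mul a c)) (fun _ => Iff.rfl) ?_
    (fun c h => ?_) c
  · rw [mul_zero, add_zero, add_zero]
  · rw [add_succ, mul_succ, h, mul_succ, add_assoc]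

theorem mul_assoc (a b c : M) : mul (mul a b) c = mul a (mul b c) := by
  refine induct (Tm.mul (Tm.mul #1 #2) #0 ≐ Tm.mul #1 (Tm.mul #2 #0)) ![a, b]
    (P := fun c => mul (mul a b) c = mul a (mul b c)) (fun _ => Iff.rfl) ?_ (fun c h => ?_) c
  · rw [mul_zero, mul_zero, mul_zero]
  · rw [mul_succ, h, mul_succ, mul_add]

theorem mul_one (a : M) : mul a (succ zero) = a := by
  rw [mul_succ, mul_zero, zero_add]

end PAModel

instance : Zero M := ⟨ArithOps.zero⟩

instance : Add M := ⟨ArithOps.add⟩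

instance : CommSemiring M where
  add := ArithOps.add
  zero := ArithOps.zero
  mul := ArithOps.mul
  one := ArithOps.succ ArithOps.zero
  add_assoc := PAModel.add_assoc
  zero_add := PAModel.zero_add
  add_zero := PAModel.add_zero
  add_comm := PAModel.add_comm
  left_distrib := PAModel.mul_add
  right_distrib a b c := by
    change ArithOps.mul (ArithOps.add a b) c = ArithOps.add (ArithOps.mul a c) (ArithOps.mul b c)
    rw [PAModel.mul_comm, PAModel.mul_add, PAModel.mul_comm a c, PAModel.mul_comm b c]
  zero_mul := PAModel.zero_mul
  mul_zero := PAModel.mul_zero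
  mul_assoc := PAModel.mul_assoc
  one_mul a := (PAModel.mul_comm _ _).trans (PAModel.mul_one a)
  mul_one := PAModel.mul_one
  mul_comm := PAModel.mul_comm
  nsmul := nsmulRec

theorem succ_eq (a : M) : ArithOps.succ a = a + 1 := by
  change _ = ArithOps.add a (ArithOps.succ ArithOps.zero)
  rw [PAModel.add_succ, PAModel.add_zero]

theorem Definable.induction {P : M → Prop} (hP : Definable P) (h0 : P 0)
    (hs : ∀ a, P a → P (a + 1)) (a : M) : P a := by
  obtain ⟨n, A, e, h⟩ := hP
  exact PAModel.induct A e h h0 (fun a ha => by rw [succ_eq]; exact hs a ha) a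

section eval

variable {n : ℕ} (e : Fin n → M)

@[simp] theorem Tm.eval_var (i : Fin n) : (#i).eval e = e i := rfl

@[simp] theorem Tm.eval_zero : (Tm.zero : Tm n).eval e = 0 := rfl

@[simp] theorem Tm.eval_succ (t : Tm n) : (Tm.succ t).eval e = t.eval e + 1 := succ_eq _

@[simp] theorem Tm.eval_add (s t : Tm n) : (Tm.add s t).eval e = s.eval e + t.eval e := rfl

@[simp] theorem Tm.eval_mul (s t : Tm n) : (Tm.mul s t).eval e = s.eval e * t.eval e := rfl

@[simp] theorem eval_num (k : ℕ) : (num k : Tm n).eval e = k := by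
  induction k with
  | zero => simp [num]
  | succ k ih => simp [num, ih]

@[simp] theorem Fml.sat_eq (s t : Tm n) : (s ≐ t).Sat e ↔ s.eval e = t.eval e := Iff.rfl

@[simp] theorem Fml.sat_and (A B : Fml n) : (A ⋏ B).Sat e ↔ A.Sat e ∧ B.Sat e := Iff.rfl

@[simp] theorem Fml.sat_or (A B : Fml n) : (A ⋎ B).Sat e ↔ A.Sat e ∨ B.Sat e := Iff.rfl

@[simp] theorem Fml.sat_imp (A B : Fml n) : (A ⇒ B).Sat e ↔ (A.Sat e → B.Sat e) := Iff.rfl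

@[simp] theorem Fml.sat_all (A : Fml (n + 1)) :
    (∀₀ A).Sat e ↔ ∀ a, A.Sat (Matrix.vecCons a e) := Iff.rfl

@[simp] theorem Fml.sat_ex (A : Fml (n + 1)) :
    (∃₀ A).Sat e ↔ ∃ a, A.Sat (Matrix.vecCons a e) := Iff.rfl

theorem Fml.sat_app {k : ℕ} (A : Fml k) (σ : Fin k → Tm n) :
    (A ⬝ σ).Sat e ↔ A.Sat (fun i => (σ i).eval e) := A.sat_subst σ e

@[simp] theorem Fml.sat_app_one (A : Fml 1) (s : Tm n) :
    (A ⬝ ![s]).Sat e ↔ A.Sat ![s.eval e] := by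
  rw [Fml.sat_app, show (fun i => (![s] i).eval e) = ![s.eval e] from
      funext fun i => by fin_cases i; rfl]

@[simp] theorem Fml.sat_app_two (A : Fml 2) (s t : Tm n) :
    (A ⬝ ![s, t]).Sat e ↔ A.Sat ![s.eval e, t.eval e] := by
  rw [Fml.sat_app, show (fun i => (![s, t] i).eval e) = ![s.eval e, t.eval e] from
      funext fun i => by fin_cases i <;> rfl]

@[simp] theorem Fml.sat_app_three (A : Fml 3) (s t u : Tm n) :
    (A ⬝ ![s, t, u]).Sat e ↔ A.Sat ![s.eval e, t.eval e, u.eval e] := by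
  rw [Fml.sat_app, show (fun i => (![s, t, u] i).eval e) = ![s.eval e, t.eval e, u.eval e] from
      funext fun i => by fin_cases i <;> rfl]

@[simp] theorem Fml.sat_app_four (A : Fml 4) (s t u v : Tm n) :
    (A ⬝ ![s, t, u, v]).Sat e ↔ A.Sat ![s.eval e, t.eval e, u.eval e, v.eval e] := by
  rw [Fml.sat_app, show (fun i => (![s, t, u, v] i).eval e) =
    ![s.eval e, t.eval e, u.eval e, v.eval e] from funext fun i => by fin_cases i <;> rfl]

end eval

/-! ### Cancellation and the order in a model of PA. -/

theorem add_one_ne_zero' (a : M) : a + 1 ≠ 0 := by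
  rw [← succ_eq]; exact PAModel.succ_ne_zero a

theorem add_one_inj {a b : M} (h : a + 1 = b + 1) : a = b := by
  rw [← succ_eq, ← succ_eq] at h; exact PAModel.succ_inj h

instance : IsCancelAdd M := by
  have key : ∀ a b c : M, a + c = b + c → a = b := by
    intro a b c
    refine Definable.induction (P := fun c : M => a + c = b + c → a = b)
      ⟨2, (Tm.add #1 #0 ≐ Tm.add #2 #0) ⇒ #1 ≐ #2, ![a, b], fun _ => Iff.rfl⟩ ?_ ?_ c
    · intro h; simpa using h
    · intro c h h'
      exact h (add_one_inj (by rw [_root_.add_assoc, _root_.add_assoc]; exact h'))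
  have : IsRightCancelAdd M := ⟨fun a b c h => key b c a h⟩
  exact AddCommMagma.IsRightCancelAdd.toIsCancelAdd M

theorem eq_zero_or_eq_add_one (a : M) : a = 0 ∨ ∃ b, a = b + 1 := by
  refine Definable.induction (P := fun a : M => a = 0 ∨ ∃ b, a = b + 1)
    ⟨0, #0 ≐ Tm.zero ⋎ ∃₀ (#1 ≐ Tm.succ #0), ![], fun a => by simp⟩ (Or.inl rfl)
    (fun a _ => Or.inr ⟨a, rfl⟩) a

theorem eq_zero_of_add_eq_zero {a b : M} (h : a + b = 0) : b = 0 := by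
  rcases eq_zero_or_eq_add_one b with h' | ⟨c, rfl⟩
  · exact h'
  · rw [← _root_.add_assoc] at h
    exact absurd h (add_one_ne_zero' _)

theorem exists_add_or (a b : M) : (∃ c, a + c = b) ∨ ∃ c, b + c = a := by
  refine Definable.induction (P := fun a : M => (∃ c, a + c = b) ∨ ∃ c, b + c = a)
    ⟨1, ∃₀ (Tm.add #1 #0 ≐ #2) ⋎ ∃₀ (Tm.add #2 #0 ≐ #1), ![b], fun a => by simp⟩ ?_ ?_ a
  · exact Or.inl ⟨b, _root_.zero_add b⟩
  · rintro a (⟨c, rfl⟩ | ⟨c, rfl⟩)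
    · rcases eq_zero_or_eq_add_one c with rfl | ⟨d, rfl⟩
      · exact Or.inr ⟨1, by ring⟩
      · exact Or.inl ⟨d, by ring⟩
    · exact Or.inr ⟨c + 1, by ring⟩

noncomputable instance : LinearOrder M where
  le a b := ∃ c, a + c = b
  le_refl a := ⟨0, _root_.add_zero a⟩
  le_trans := by
    rintro a b c ⟨d, rfl⟩ ⟨e, rfl⟩
    exact ⟨d + e, by ring⟩
  le_antisymm := by
    rintro a b ⟨d, rfl⟩ ⟨e, h⟩
    rw [_root_.add_assoc] at h
    have h1 : d + e = 0 := add_left_cancel (h.trans (_root_.add_zero a).symm)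
    have h2 := eq_zero_of_add_eq_zero ((_root_.add_comm e d).trans h1)
    rw [h2, _root_.add_zero]
  le_total a b := exists_add_or a b
  toDecidableLE := Classical.decRel _

theorem le_def {a b : M} : a ≤ b ↔ ∃ c, a + c = b := Iff.rfl

instance : IsOrderedCancelAddMonoid M where
  add_le_add_left := by
    rintro a b ⟨d, rfl⟩ c
    exact ⟨d, by ring⟩
  le_of_add_le_add_left := by
    rintro a b c ⟨d, h⟩
    exact ⟨d, add_left_cancel (by rw [← h]; ring : a + (b + d) = a + c)⟩

theorem lt_iff_add_one_le {a b : M} : a < b ↔ a + 1 ≤ b := by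
  constructor
  · intro h
    obtain ⟨c, rfl⟩ := h.le
    rcases eq_zero_or_eq_add_one c with rfl | ⟨d, rfl⟩
    · simp at h
    · exact ⟨d, by ring⟩
  · rintro ⟨c, rfl⟩
    refine lt_of_le_of_ne ⟨1 + c, by ring⟩ fun h => ?_
    rw [_root_.add_assoc] at h
    have h1 := add_left_cancel ((_root_.add_zero a).trans h)
    rw [_root_.add_comm] at h1
    exact add_one_ne_zero' _ h1.symm

theorem lt_def {a b : M} : a < b ↔ ∃ c, a + c + 1 = b := by
  rw [lt_iff_add_one_le]
  exact ⟨fun ⟨c, h⟩ => ⟨c, by rw [← h]; ring⟩, fun ⟨c, h⟩ => ⟨c, by rw [← h]; ring⟩⟩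

instance : CanonicallyOrderedAdd M where
  exists_add_of_le := by
    rintro a b ⟨c, rfl⟩
    exact ⟨c, rfl⟩
  le_add_self a b := ⟨b, _root_.add_comm a b⟩
  le_self_add a b := ⟨b, rfl⟩

instance : Nontrivial M := ⟨0, 1, fun h => add_one_ne_zero' (0 : M) (by rw [_root_.zero_add, h])⟩

instance : IsStrictOrderedRing M where
  zero_le_one := zero_le
  mul_lt_mul_of_pos_left a ha b c h := by
    obtain ⟨d, rfl⟩ := lt_def.1 h
    obtain ⟨a', rfl⟩ := lt_def.1 ha
    exact lt_def.2 ⟨(a' + d + a' * d), by ring⟩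
  mul_lt_mul_of_pos_right a ha b c h := by
    obtain ⟨d, rfl⟩ := lt_def.1 h
    obtain ⟨a', rfl⟩ := lt_def.1 ha
    exact lt_def.2 ⟨(a' + d + a' * d), by ring⟩

theorem lt_add_one_iff' {a b : M} : a < b + 1 ↔ a ≤ b := by
  rw [lt_iff_add_one_le]; exact add_le_add_iff_right 1

@[simp] theorem sat_leF (a b : M) : leF.Sat ![a, b] ↔ a ≤ b := by
  simp [leF, le_def]

@[simp] theorem sat_ltF (a b : M) : ltF.Sat ![a, b] ↔ a < b := by
  simp [ltF, lt_def]

end Model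

/-! ### Coding of finite sequences in a model -/

section Coding

variable {M : Type} [PAModel M]

theorem eval_cases {n m : ℕ} (t : Tm m) (σ : Fin n → Tm m) (e : Fin m → M) :
    (fun i => (Fin.cases (motive := fun _ => Tm m) t σ i).eval e) =
      Matrix.vecCons (t.eval e) (fun j => (σ j).eval e) := by
  funext i
  exact Fin.cases rfl (fun _ => rfl) i

/-- The pairing function. -/
def cpair (a b : M) : M := (a + b) * (a + b) + a

@[simp] theorem eval_pr {n : ℕ} (s t : Tm n) (e : Fin n → M) :
    (pr s t).eval e = cpair (s.eval e) (t.eval e) := rfl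

@[simp] theorem eval_tag₁ {n : ℕ} (c : ℕ) (t : Tm n) (e : Fin n → M) :
    (tag₁ c t).eval e = cpair (c : M) (t.eval e) := by simp [tag₁]

@[simp] theorem eval_tag₂ {n : ℕ} (c : ℕ) (s t : Tm n) (e : Fin n → M) :
    (tag₂ c s t).eval e = cpair (c : M) (cpair (s.eval e) (t.eval e)) := by simp [tag₂]

@[simp] theorem eval_tr {n : ℕ} (s t u : Tm n) (e : Fin n → M) :
    (tr s t u).eval e = cpair (s.eval e) (cpair (t.eval e) (u.eval e)) := rfl

@[simp] theorem eval_qu {n : ℕ} (s t u v : Tm n) (e : Fin n → M) : (qu s t u v).eval e =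
    cpair (s.eval e) (cpair (t.eval e) (cpair (u.eval e) (v.eval e))) := rfl

/-- With `s = a + b < c + d`, already `(c + d)² ≥ s² + 2s + 1` exceeds `s² + a`. Subtraction being
unavailable, the contradiction takes the form of a successor equal to `0`. -/
theorem add_eq_add_of_cpair_eq {a b c d : M} (h : cpair a b = cpair c d) : c + d ≤ a + b := by
  by_contra! h'
  obtain ⟨r, hr⟩ := lt_def.1 h'
  unfold cpair at h
  rw [← hr] at h
  have h1 : a = (2 * (a + b) * r + r * r + 2 * r + 1) + (2 * a + 2 * b + c) := by grind
  have h2 : a + (2 * (a + b) * r + r * r + 2 * r + a + 2 * b + c + 1) = a + 0 := by grind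
  exact add_one_ne_zero' _ (add_left_cancel h2)

@[simp] theorem cpair_inj {a b c d : M} : cpair a b = cpair c d ↔ a = c ∧ b = d := by
  constructor
  · intro h
    have h1 := le_antisymm (add_eq_add_of_cpair_eq h.symm) (add_eq_add_of_cpair_eq h)
    have h2 := h
    unfold cpair at h2
    rw [h1] at h2
    have h3 := add_left_cancel h2
    subst h3
    exact ⟨rfl, add_left_cancel h1⟩
  · rintro ⟨rfl, rfl⟩
    rfl

/-- Gödel's β-function, as a relation: `y` is entry number `i` of the sequence coded by `c, d`. -/
def Beta (y c d i : M) : Prop := ∃ q, c = q * ((i + 1) * d + 1) + y ∧ y ≤ (i + 1) * d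

@[simp] theorem sat_betaF (y c d i : M) : betaF.Sat ![y, c, d, i] ↔ Beta y c d i := by
  simp [betaF, Beta]

/-- Uniqueness of division with remainder: with a smaller quotient, the remainder would reach the
modulus `(i + 1) * d + 1`. -/
theorem Beta.unique {y y' c d i : M} (h : Beta y c d i) (h' : Beta y' c d i) : y = y' := by
  have h01 : (0 : M) < 1 := zero_lt_one
  have key : ∀ {y y' q q' : M}, q * ((i + 1) * d + 1) + y = q' * ((i + 1) * d + 1) + y' →
      y ≤ (i + 1) * d → ¬ q < q' := by
    intro y y' q q' h hy hq
    obtain ⟨r, rfl⟩ := lt_def.1 hq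
    have h1 : y = (r * ((i + 1) * d + 1) + y') + (i + 1) * d + 1 := by grind
    have h2 : (0 : M) ≤ r * ((i + 1) * d + 1) + y' := zero_le
    grind
  obtain ⟨q, hq, hy⟩ := h
  obtain ⟨q', hq', hy'⟩ := h'
  have h1 := key (hq.symm.trans hq') hy
  have h2 := key (hq'.symm.trans hq) hy'
  have h3 : q = q' := le_antisymm (not_lt.1 h2) (not_lt.1 h1)
  subst h3
  exact add_left_cancel (hq.symm.trans hq')

/-- A factorial in disguise. No factorial function exists in `M` yet, so only the existence of a
multiple is carried through a definable induction. -/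
theorem exists_common_multiple (n : M) : ∃ m : M, m ≠ 0 ∧ ∀ j, j < n → ∃ c, m = (j + 1) * c := by
  refine Definable.induction
    (P := fun n : M => ∃ m : M, m ≠ 0 ∧ ∀ j, j < n → ∃ c, m = (j + 1) * c)
    ⟨0, ∃₀ ((#0 ≐ Tm.zero ⇒ Fml.bot) ⋏ ∀₀ (ltF ⬝ ![#0, #2] ⇒
      ∃₀ (#2 ≐ Tm.mul (Tm.succ #1) #0))), ![], fun a => by simp [Fml.bot]⟩ ?_ ?_ n
  · exact ⟨1, one_ne_zero, fun j hj => absurd hj not_lt_zero⟩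
  · rintro n ⟨m, hm, h⟩
    refine ⟨m * (n + 1), mul_ne_zero hm (add_one_ne_zero' n), fun j hj => ?_⟩
    rcases (lt_add_one_iff'.1 hj).lt_or_eq with hj | rfl
    · obtain ⟨c, hc⟩ := h j hj
      exact ⟨c * (n + 1), by rw [hc]; ring⟩
    · exact ⟨m, by ring⟩

/-- Binary relations that are definable with parameters. -/
def Definable₂ (F : M → M → Prop) : Prop :=
  ∃ (n : ℕ) (A : Fml (n + 2)) (e : Fin n → M),
    ∀ a b, F a b ↔ A.Sat (Matrix.vecCons a (Matrix.vecCons b e))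

/-- Collection, by induction on initial segments of `N`. The values below a possibly nonstandard `N`
have no maximum for free. -/
theorem exists_bound_of_definable {F : M → M → Prop} (hF : Definable₂ F) {N : M}
    (h : ∀ i, i < N → ∃ z, F z i) : ∃ B, ∀ i, i < N → ∃ z, z ≤ B ∧ F z i := by
  obtain ⟨n, A, e, hA⟩ := hF
  have key : ∀ k, k ≤ N → ∃ B, ∀ i, i < k → ∃ z, z ≤ B ∧ F z i := by
    refine Definable.induction
      ⟨n + 1, leF ⬝ ![#0, #1] ⇒ ∃₀ ∀₀ (ltF ⬝ ![#0, #2] ⇒ ∃₀ (leF ⬝ ![#0, #2] ⋏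
        A.subst (Fin.cases #0 (Fin.cases #1 (fun j => #(j.succ.succ.succ.succ.succ)))))),
        Matrix.vecCons N e, fun a => ?_⟩ ?_ ?_
    · simp [hA, Fml.sat_subst, eval_cases]
    · exact fun _ => ⟨0, fun i hi => absurd hi not_lt_zero⟩
    · intro k ih hk
      have hk' := lt_iff_add_one_le.2 hk
      obtain ⟨B, hB⟩ := ih hk'.le
      obtain ⟨z, hz⟩ := h k hk'
      refine ⟨max B z, fun i hi => ?_⟩
      rcases (lt_add_one_iff'.1 hi).lt_or_eq with hi | rfl
      · obtain ⟨w, hw, hF⟩ := hB i hi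
        exact ⟨w, hw.trans (le_max_left _ _), hF⟩
      · exact ⟨z, le_max_right _ _, hz⟩
  exact key N le_rfl

/-- Write `m_i = (i+1)d + 1` and `s = (k+1)d`, so `m_k = s + 1` and `s ≡ -1` modulo `m_k`. From
`(k+1)·m_i = (i+1)·m_k + (r+1)` one gets `e(k+1)²·m_i ≡ s`, hence `e(k+1)²s` is an inverse of `m_i`.
-/
theorem modulus_invertible {d i k e r : M} (hk : k = i + r + 1) (hd : d = (r + 1) * e) :
    ∃ u v, ((i + 1) * d + 1) * u = 1 + v * ((k + 1) * d + 1) := by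
  subst hk hd
  generalize hs : (i + r + 1 + 1) * ((r + 1) * e) = s
  -- The summand `(s² + 1)(s + 1)` is a multiple of the modulus `m_k`, added only to keep all
  -- quantities free of subtraction.
  refine ⟨e * (i + r + 1 + 1) * (i + r + 1 + 1) * s + (s * s + 1) * (s + 1),
    e * (i + r + 1 + 1) * (i + r + 1 + 1) * s + s + (s * s + 1) * ((i + 1) * ((r + 1) * e)), ?_⟩
  subst hs
  ring

/-- Every definable finite sequence has a code. -/
theorem exists_beta {F : M → M → Prop} (hF : Definable₂ F) {N : M}
    (h : ∀ i, i < N → ∃ z, F z i) : ∃ c d, ∀ i, i < N → ∃ z, F z i ∧ Beta z c d i := by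
  obtain ⟨B, hB⟩ := exists_bound_of_definable hF h
  obtain ⟨m, hm, hdvd⟩ := exists_common_multiple N
  obtain ⟨m', rfl⟩ := (eq_zero_or_eq_add_one m).resolve_left hm
  -- The factor `m' + 1` is divisible by every `r + 1` with `r < N`, which makes the moduli coprime.
  -- The factor `B + 1` makes them large enough for the residues.
  obtain ⟨d, hd⟩ : ∃ d, d = (m' + 1) * (B + 1) := ⟨_, rfl⟩
  have hdB : B ≤ d := by
    rw [hd]
    exact ⟨m' * (B + 1) + 1, by ring⟩
  obtain ⟨n, A, e, hA⟩ := hF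
  -- `P` plays the product of the first `k` moduli: divisible by each of them and invertible modulo
  -- the later ones. This is all that the Chinese remainder argument uses.
  have key : ∀ k, k ≤ N → ∃ P c, (∀ i, i < k → ∃ t, P = ((i + 1) * d + 1) * t) ∧
      (∀ j, k ≤ j → j < N → ∃ u v, P * u = 1 + v * ((j + 1) * d + 1)) ∧
      ∀ i, i < k → ∃ z, F z i ∧ Beta z c d i := by
    refine Definable.induction
      ⟨n + 2, leF ⬝ ![#0, #1] ⇒ ∃₀ ∃₀ (
        ∀₀ (ltF ⬝ ![#0, #3] ⇒
          ∃₀ (#3 ≐ Tm.mul (Tm.succ (Tm.mul (Tm.succ #1) #6)) #0)) ⋏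
        ∀₀ (leF ⬝ ![#3, #0] ⇒ ltF ⬝ ![#0, #4] ⇒ ∃₀ ∃₀
          (Tm.mul #4 #1 ≐ Tm.succ (Tm.mul #0 (Tm.succ (Tm.mul (Tm.succ #2) #7))))) ⋏
        ∀₀ (ltF ⬝ ![#0, #3] ⇒ ∃₀ (
          A.subst (Fin.cases #0 (Fin.cases #1 (fun j => #(j.succ.succ.succ.succ.succ.succ.succ))))
            ⋏ betaF ⬝ ![#0, #2, #6, #1]))),
        Matrix.vecCons N (Matrix.vecCons d e), fun a => ?_⟩ ?_ ?_
    · simp [hA, Fml.sat_subst, eval_cases, _root_.add_comm (1 : M)]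
    · exact fun _ => ⟨1, 0, fun i hi => absurd hi not_lt_zero, fun j _ _ => ⟨1, 0, by ring⟩,
        fun i hi => absurd hi not_lt_zero⟩
    · intro k ih hk
      have hk' := lt_iff_add_one_le.2 hk
      obtain ⟨P, c, h1, h2, h3⟩ := ih hk'.le
      obtain ⟨u, v, huv⟩ := h2 k le_rfl hk'
      obtain ⟨z, hzB, hz⟩ := hB k hk'
      -- Modulo the new modulus, `P * u ≡ 1` and `(k + 1) * d ≡ -1`, so the new code is `≡ c + z - c
      -- = z`. Modulo the old ones it is `≡ c`, because they divide `P`.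
      refine ⟨P * ((k + 1) * d + 1), c + P * u * (z + c * ((k + 1) * d)), ?_, ?_, ?_⟩
      · intro i hi
        rcases (lt_add_one_iff'.1 hi).lt_or_eq with hi | rfl
        · obtain ⟨t, ht⟩ := h1 i hi
          exact ⟨t * ((k + 1) * d + 1), by rw [ht]; ring⟩
        · exact ⟨P, by ring⟩
      · intro j hkj hj
        obtain ⟨r, hr⟩ := hkj
        obtain ⟨x, y, hxy⟩ := h2 j (le_trans ⟨1, rfl⟩ ⟨r, hr⟩) hj
        obtain ⟨f, hf⟩ := hdvd r (lt_of_le_of_lt ⟨k + 1, by rw [← hr]; ring⟩ hj)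
        obtain ⟨x', y', hxy'⟩ := modulus_invertible (d := d) (i := k) (k := j) (r := r)
          (e := f * (B + 1)) (by rw [← hr]; ring) (by rw [hd, hf]; ring)
        refine ⟨x * x', y + y' + y * y' * ((j + 1) * d + 1), ?_⟩
        calc P * ((k + 1) * d + 1) * (x * x') = (P * x) * (((k + 1) * d + 1) * x') := by ring
          _ = _ := by rw [hxy, hxy']; ring
      · intro i hi
        rcases (lt_add_one_iff'.1 hi).lt_or_eq with hi | rfl
        · obtain ⟨w, hw, q, hq, hle⟩ := h3 i hi
          obtain ⟨t, ht⟩ := h1 i hi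
          refine ⟨w, hw, q + t * u * (z + c * ((k + 1) * d)), ?_, hle⟩
          rw [ht]
          calc _ = (q * ((i + 1) * d + 1) + w) +
                ((i + 1) * d + 1) * t * u * (z + c * ((k + 1) * d)) := by rw [← hq]
            _ = _ := by ring
        · refine ⟨z, hz, c + v * (z + c * ((i + 1) * d)), ?_, ?_⟩
          · rw [huv]; ring
          · refine hzB.trans (hdB.trans ⟨i * d, by ring⟩)
  obtain ⟨P, c, -, -, h3⟩ := key N le_rfl
  exact ⟨c, d, h3⟩

/-! ### Derivations in a model -/

/-- The sequence coded by `c, d` is a derivation up to its entry number `n`. -/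
def IsDerivation (B : M → Prop) (St : M → M → M → Prop) (c d n : M) : Prop :=
  ∀ i, i ≤ n → ∃ z, Beta z c d i ∧
    (B z ∨ ∃ j k p q, j < i ∧ k < i ∧ Beta p c d j ∧ Beta q c d k ∧ St z p q)

/-- `y` has a derivation. -/
def Der (B : M → Prop) (St : M → M → M → Prop) (y : M) : Prop :=
  ∃ c d n, Beta y c d n ∧ IsDerivation B St c d n

theorem sat_derivationF (base : Fml 1) (step : Fml 3) (x y : M) :
    (derivationF base step).Sat ![x, y] ↔ ∃ c d n, x = cpair c (cpair d n) ∧ Beta y c d n ∧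
      IsDerivation (fun z => base.Sat ![z]) (fun z p q => step.Sat ![z, p, q]) c d n := by
  simp [derivationF, IsDerivation]

theorem sat_derF (base : Fml 1) (step : Fml 3) (y : M) : (derF base step).Sat ![y] ↔
    Der (fun z => base.Sat ![z]) (fun z p q => step.Sat ![z, p, q]) y := by
  simp only [derF, Fml.sat_ex, Fml.sat_app_two, Tm.eval_var, Matrix.cons_val_zero,
    Matrix.cons_val_one, sat_derivationF, Der]
  constructor
  · rintro ⟨x, c, d, n, -, h⟩
    exact ⟨c, d, n, h⟩
  · rintro ⟨c, d, n, h⟩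
    exact ⟨_, c, d, n, rfl, h⟩

variable {B : M → Prop} {St : M → M → M → Prop}

theorem IsDerivation.mono {c d n m : M} (h : IsDerivation B St c d n) (hm : m ≤ n) :
    IsDerivation B St c d m :=
  fun i hi => h i (hi.trans hm)

/-- An initial segment of a derivation is a derivation, so the premises of the last step are
derivable too. -/
theorem IsDerivation.inv {c d n y : M} (h : IsDerivation B St c d n) (hy : Beta y c d n) :
    B y ∨ ∃ p q, Der B St p ∧ Der B St q ∧ St y p q := by
  obtain ⟨z, hz, h1⟩ := h n le_rfl
  obtain rfl := hz.unique hy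
  refine h1.imp_right ?_
  rintro ⟨j, k, p, q, hj, hk, hp, hq, hs⟩
  exact ⟨p, q, ⟨c, d, j, hp, h.mono hj.le⟩, ⟨c, d, k, hq, h.mono hk.le⟩, hs⟩

theorem Der.inv {y : M} (h : Der B St y) : B y ∨ ∃ p q, Der B St p ∧ Der B St q ∧ St y p q := by
  obtain ⟨c, d, n, hy, h⟩ := h
  exact h.inv hy

/-- Induction on derivations. -/
theorem Der.induction {P : M → Prop} (hP : Definable P) (hB : ∀ z, B z → P z)
    (hS : ∀ z p q, Der B St p → Der B St q → P p → P q → St z p q → P z) {y : M}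
    (h : Der B St y) : P y := by
  obtain ⟨c, d, n, hy, h⟩ := h
  obtain ⟨m, A, e, hA⟩ := hP
  -- Course-of-values induction on the position, put as ordinary induction on a strict bound.
  have key : ∀ i, ∀ j, j < i → j ≤ n → ∀ z, Beta z c d j → P z := by
    refine Definable.induction
      ⟨m + 3, ∀₀ (ltF ⬝ ![#0, #1] ⇒ leF ⬝ ![#0, #4] ⇒ ∀₀ (betaF ⬝ ![#0, #3, #4, #1] ⇒
        A.subst (Fin.cases #0 (fun j => #(j.succ.succ.succ.succ.succ.succ))))),
        Matrix.vecCons c (Matrix.vecCons d (Matrix.vecCons n e)), fun a => ?_⟩ ?_ ?_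
    · simp [hA, Fml.sat_subst, eval_cases]
    · exact fun j hj => absurd hj not_lt_zero
    · intro i ih j hj hjn z hz
      rcases (lt_add_one_iff'.1 hj).lt_or_eq with hj | rfl
      · exact ih j hj hjn z hz
      · obtain ⟨z', hz', h1⟩ := h j hjn
        obtain rfl := hz'.unique hz
        rcases h1 with h1 | ⟨k, l, p, q, hk, hl, hp, hq, hs⟩
        · exact hB _ h1
        · exact hS _ p q ⟨c, d, k, hp, h.mono (hk.le.trans hjn)⟩
            ⟨c, d, l, hq, h.mono (hl.le.trans hjn)⟩ (ih k hk (hk.le.trans hjn) p hp)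
            (ih l hl (hl.le.trans hjn) q hq) hs
  exact key (n + 1) n (lt_add_one_iff'.2 le_rfl) le_rfl y hy

theorem Der.base {y : M} (h : B y) : Der B St y := by
  obtain ⟨c, d, h1⟩ := exists_beta (M := M) (F := fun z _ => z = y) (N := 1)
    ⟨1, #0 ≐ #2, ![y], fun a b => Iff.rfl⟩ (fun _ _ => ⟨y, rfl⟩)
  have h2 : Beta y c d 0 := by
    obtain ⟨z, rfl, hz⟩ := h1 0 zero_lt_one
    exact hz
  refine ⟨c, d, 0, h2, fun i hi => ?_⟩
  obtain rfl := le_antisymm hi zero_le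
  exact ⟨y, h2, Or.inl h⟩

/-- Concatenation: the first derivation keeps the positions `0, …, n₁`, the second is shifted by `n₁
+ 1`, and `y` is placed at the end. The joint sequence is recoded by `exists_beta`. -/
theorem Der.step {y p q : M} (hp : Der B St p) (hq : Der B St q) (h : St y p q) : Der B St y := by
  obtain ⟨c₁, d₁, n₁, hp, h₁⟩ := hp
  obtain ⟨c₂, d₂, n₂, hq, h₂⟩ := hq
  have h01 : (0 : M) < 1 := zero_lt_one
  let F : M → M → Prop := fun z i => (i ≤ n₁ ∧ Beta z c₁ d₁ i) ∨
    (∃ j, j ≤ n₂ ∧ i = n₁ + 1 + j ∧ Beta z c₂ d₂ j) ∨ (i = n₁ + 1 + n₂ + 1 ∧ z = y)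
  have hF : Definable₂ F := ⟨7, (leF ⬝ ![#1, #4] ⋏ betaF ⬝ ![#0, #2, #3, #1]) ⋎
    ∃₀ (leF ⬝ ![#0, #8] ⋏ #2 ≐ Tm.add (Tm.succ #5) #0 ⋏ betaF ⬝ ![#1, #6, #7, #0]) ⋎
    (#1 ≐ Tm.succ (Tm.add (Tm.succ #4) #7) ⋏ #0 ≐ #8), ![c₁, d₁, n₁, c₂, d₂, n₂, y],
    fun a b => by simp [F]⟩
  have hcase : ∀ i, i < n₁ + 1 + n₂ + 1 + 1 →
      i ≤ n₁ ∨ (∃ j, j ≤ n₂ ∧ i = n₁ + 1 + j) ∨ i = n₁ + 1 + n₂ + 1 := by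
    intro i hi
    rcases le_or_gt i n₁ with hi' | hi'
    · exact Or.inl hi'
    · obtain ⟨r, hr⟩ := lt_def.1 hi'
      rcases (lt_add_one_iff'.1 hi).lt_or_eq with hi | rfl
      · have h1 : n₁ + 1 + r < n₁ + 1 + (n₂ + 1) := by
          convert hi using 1
          · rw [← hr]; ring
          · ring
        exact Or.inr (Or.inl ⟨r, lt_add_one_iff'.1 (lt_of_add_lt_add_left h1), by rw [← hr]; ring⟩)
      · exact Or.inr (Or.inr rfl)
  obtain ⟨c, d, hcd⟩ := exists_beta hF (N := n₁ + 1 + n₂ + 1 + 1) (by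
    intro i hi
    rcases hcase i hi with h | ⟨j, hj, rfl⟩ | rfl
    · obtain ⟨z, hz, -⟩ := h₁ i h
      exact ⟨z, Or.inl ⟨h, hz⟩⟩
    · obtain ⟨z, hz, -⟩ := h₂ j hj
      exact ⟨z, Or.inr (Or.inl ⟨j, hj, rfl, hz⟩)⟩
    · exact ⟨y, Or.inr (Or.inr ⟨rfl, rfl⟩)⟩)
  have e₁ : ∀ i z, i ≤ n₁ → Beta z c₁ d₁ i → Beta z c d i := by
    intro i z hi hz
    have hn : (0 : M) ≤ n₂ := zero_le
    obtain ⟨w, hw, hb⟩ := hcd i (by grind)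
    rcases hw with hw | ⟨j, -, rfl, -⟩ | ⟨rfl, -⟩
    · rwa [hz.unique hw.2]
    · have hn' : (0 : M) ≤ j := zero_le
      grind
    · grind
  have e₂ : ∀ i z, i ≤ n₂ → Beta z c₂ d₂ i → Beta z c d (n₁ + 1 + i) := by
    intro i z hi hz
    have hn : (0 : M) ≤ i := zero_le
    obtain ⟨w, hw, hb⟩ := hcd (n₁ + 1 + i) (by grind)
    rcases hw with hw | ⟨j, -, hj, hw⟩ | ⟨h, -⟩
    · grind
    · obtain rfl := add_left_cancel hj
      rwa [hz.unique hw]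
    · grind
  have e₃ : Beta y c d (n₁ + 1 + n₂ + 1) := by
    obtain ⟨w, hw, hb⟩ := hcd (n₁ + 1 + n₂ + 1) (by grind)
    have hn : (0 : M) ≤ n₂ := zero_le
    rcases hw with hw | ⟨j, hj, hj', -⟩ | ⟨-, rfl⟩
    · grind
    · grind
    · exact hb
  refine ⟨c, d, n₁ + 1 + n₂ + 1, e₃, fun i hi => ?_⟩
  rcases hcase i (lt_add_one_iff'.2 hi) with hi | ⟨j, hj, rfl⟩ | rfl
  · obtain ⟨z, hz, hz'⟩ := h₁ i hi
    refine ⟨z, e₁ i z hi hz, hz'.imp_right ?_⟩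
    rintro ⟨j, k, p', q', hj, hk, hp', hq', hs⟩
    exact ⟨j, k, p', q', hj, hk, e₁ j p' (hj.le.trans hi) hp', e₁ k q' (hk.le.trans hi) hq', hs⟩
  · obtain ⟨z, hz, hz'⟩ := h₂ j hj
    refine ⟨z, e₂ j z hj hz, hz'.imp_right ?_⟩
    rintro ⟨i, k, p', q', hi, hk, hp', hq', hs⟩
    exact ⟨n₁ + 1 + i, n₁ + 1 + k, p', q', by grind, by grind, e₂ i p' (hi.le.trans hj) hp',
      e₂ k q' (hk.le.trans hj) hq', hs⟩
  · refine ⟨y, e₃, Or.inr ⟨n₁, n₁ + 1 + n₂, p, q, ?_, ?_, e₁ n₁ p le_rfl hp,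
      e₂ n₂ q le_rfl hq, h⟩⟩
    · have hn : (0 : M) ≤ n₂ := zero_le
      grind
    · grind

end Coding

/-! ### Arithmetized syntax in a model -/

section ArithmetizedFormulas

variable {M : Type} [PAModel M]

/-- `t` is the code of the numeral of `n`. -/
def Numeral (n t : M) : Prop :=
  Der (fun z => z = cpair 0 (cpair 1 0))
    (fun z p _ => ∃ n t, p = cpair n t ∧ z = cpair (n + 1) (cpair 2 t)) (cpair n t)

@[simp] theorem sat_numeralF (n t : M) : numeralF.Sat ![n, t] ↔ Numeral n t := by
  simp [numeralF, sat_derF, Numeral]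

/-- `t` is the code of a term with `n` variables. -/
def Term (n t : M) : Prop :=
  Der (fun y => ∃ n, y = cpair n (cpair 1 0) ∨ ∃ i, i < n ∧ y = cpair n (cpair 0 i))
    (fun y p q => ∃ n s t, p = cpair n s ∧ q = cpair n t ∧ (y = cpair n (cpair 2 s) ∨
      y = cpair n (cpair 3 (cpair s t)) ∨ y = cpair n (cpair 4 (cpair s t)))) (cpair n t)

@[simp] theorem sat_termF (n t : M) : termF.Sat ![n, t] ↔ Term n t := by
  simp [termF, sat_derF, Term]

/-- `A` is the code of a formula with `n` variables. -/
def Formula (n A : M) : Prop :=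
  Der (fun y => ∃ n s t, Term n s ∧ Term n t ∧
      (y = cpair n (cpair 5 (cpair s t)) ∨ y = cpair n (cpair 6 s)))
    (fun y p q => ∃ n A B, (p = cpair n A ∧ q = cpair n B ∧ (y = cpair n (cpair 7 (cpair A B)) ∨
      y = cpair n (cpair 8 (cpair A B)) ∨ y = cpair n (cpair 9 (cpair A B)))) ∨
      (p = cpair (n + 1) A ∧ (y = cpair n (cpair 10 A) ∨ y = cpair n (cpair 11 A)))) (cpair n A)

@[simp] theorem sat_formulaF (n A : M) : formulaF.Sat ![n, A] ↔ Formula n A := by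
  simp [formulaF, sat_derF, Formula]

@[simp] theorem sat_sentenceF (A : M) : sentenceF.Sat ![A] ↔ Formula 0 A := by
  simp [sentenceF]

/-- `z` is the result of putting the closed term `t` for the variable `j` in `x`. -/
def Subst (j t x z : M) : Prop :=
  Der (fun y => ∃ j t, y = cpair j (cpair t (cpair (cpair 0 j) t)) ∨
      y = cpair j (cpair t (cpair (cpair 1 0) (cpair 1 0))) ∨
      ∃ i, ¬ i = j ∧ y = cpair j (cpair t (cpair (cpair 0 i) (cpair 0 i))))
    (fun y p q => ∃ j t a a' b b', (p = cpair j (cpair t (cpair a a')) ∧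
        (y = cpair j (cpair t (cpair (cpair 2 a) (cpair 2 a'))) ∨
         y = cpair j (cpair t (cpair (cpair 6 a) (cpair 6 a'))))) ∨
      (p = cpair j (cpair t (cpair a a')) ∧ q = cpair j (cpair t (cpair b b')) ∧
        (y = cpair j (cpair t (cpair (cpair 3 (cpair a b)) (cpair 3 (cpair a' b')))) ∨
         y = cpair j (cpair t (cpair (cpair 4 (cpair a b)) (cpair 4 (cpair a' b')))) ∨
         y = cpair j (cpair t (cpair (cpair 5 (cpair a b)) (cpair 5 (cpair a' b')))) ∨
         y = cpair j (cpair t (cpair (cpair 7 (cpair a b)) (cpair 7 (cpair a' b')))) ∨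
         y = cpair j (cpair t (cpair (cpair 8 (cpair a b)) (cpair 8 (cpair a' b')))) ∨
         y = cpair j (cpair t (cpair (cpair 9 (cpair a b)) (cpair 9 (cpair a' b')))))) ∨
      (p = cpair (j + 1) (cpair t (cpair a a')) ∧
        (y = cpair j (cpair t (cpair (cpair 10 a) (cpair 10 a'))) ∨
         y = cpair j (cpair t (cpair (cpair 11 a) (cpair 11 a'))))))
    (cpair j (cpair t (cpair x z)))

@[simp] theorem sat_substF (j t x z : M) : substF.Sat ![j, t, x, z] ↔ Subst j t x z := by
  simp [substF, sat_derF, Subst, Fml.neg, Fml.bot]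

@[simp] theorem sat_substNumF (j n x z : M) :
    substNumF.Sat ![j, n, x, z] ↔ ∃ t, Numeral n t ∧ Subst j t x z := by
  simp [substNumF]

/-- `p` is the code of `∀ … ∀ a`, with `k` quantifiers. -/
def Alls (k a p : M) : Prop :=
  Der (fun y => ∃ a, y = cpair 0 (cpair a a))
    (fun y p _ => ∃ k a x, p = cpair k (cpair a x) ∧ y = cpair (k + 1) (cpair a (cpair 10 x)))
    (cpair k (cpair a p))

@[simp] theorem sat_allsF (k a p : M) : allsF.Sat ![k, a, p] ↔ Alls k a p := by
  simp [allsF, sat_derF, Alls]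

/-- `y` follows from `p` and `q` by modus ponens under `k` quantifiers. -/
def ModusPonens (k p q y : M) : Prop :=
  ∃ a b, Alls k a p ∧ Alls k (cpair 9 (cpair a b)) q ∧ Alls k b y

@[simp] theorem sat_modusPonensF (p q y : M) :
    modusPonensF.Sat ![p, q, y] ↔ ∃ k, ModusPonens k p q y := by
  simp [modusPonensF, ModusPonens]

/-! #### Numerals and terms -/

theorem Term.zero (n : M) : Term n (cpair 1 0) := Der.base ⟨n, Or.inl rfl⟩

theorem Term.var {n i : M} (h : i < n) : Term n (cpair 0 i) := Der.base ⟨n, Or.inr ⟨i, h, rfl⟩⟩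

theorem Term.succ {n s : M} (h : Term n s) : Term n (cpair 2 s) :=
  Der.step h h ⟨n, s, s, rfl, rfl, Or.inl rfl⟩

theorem Term.add {n s t : M} (h : Term n s) (h' : Term n t) : Term n (cpair 3 (cpair s t)) :=
  Der.step h h' ⟨n, s, t, rfl, rfl, Or.inr (Or.inl rfl)⟩

theorem Term.mul {n s t : M} (h : Term n s) (h' : Term n t) : Term n (cpair 4 (cpair s t)) :=
  Der.step h h' ⟨n, s, t, rfl, rfl, Or.inr (Or.inr rfl)⟩

/-- Numerals are closed, hence terms over any number of variables. This is why they can be moved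
under quantifiers without shifting. -/
theorem Numeral.term {n t : M} (h : Numeral n t) (k : M) : Term k t := by
  refine Der.induction (P := fun y => ∀ n t, y = cpair n t → Term k t)
    ⟨1, ∀₀ ∀₀ (#2 ≐ pr #1 #0 ⇒ termF ⬝ ![#3, #0]), ![k], fun a => by simp⟩ ?_ ?_ h n t rfl
  · rintro _ rfl n t h
    obtain ⟨-, rfl⟩ := cpair_inj.1 h
    exact Term.zero k
  · rintro _ p - - - hp - ⟨n, t, rfl, rfl⟩ n' t' h
    obtain ⟨-, rfl⟩ := cpair_inj.1 h
    exact (hp n t rfl).succ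

/-- Induction on terms. -/
theorem Term.induction {P : M → M → Prop}
    (hP : Definable (fun y => ∀ n t, y = cpair n t → P n t)) (hzero : ∀ n, P n (cpair 1 0))
    (hvar : ∀ n i, i < n → P n (cpair 0 i)) (hsucc : ∀ n s, P n s → P n (cpair 2 s))
    (hadd : ∀ n s t, P n s → P n t → P n (cpair 3 (cpair s t)))
    (hmul : ∀ n s t, P n s → P n t → P n (cpair 4 (cpair s t))) {n t : M} (h : Term n t) :
    P n t := by
  refine Der.induction hP ?_ ?_ h n t rfl
  · rintro _ ⟨n, rfl | ⟨i, hi, rfl⟩⟩ n' t' h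
    · obtain ⟨rfl, rfl⟩ := cpair_inj.1 h
      exact hzero _
    · obtain ⟨rfl, rfl⟩ := cpair_inj.1 h
      exact hvar _ _ hi
  · rintro _ p q - - hp hq ⟨n, s, t, rfl, rfl, rfl | rfl | rfl⟩ n' t' h
    · obtain ⟨rfl, rfl⟩ := cpair_inj.1 h
      exact hsucc _ _ (hp _ _ rfl)
    · obtain ⟨rfl, rfl⟩ := cpair_inj.1 h
      exact hadd _ _ _ (hp _ _ rfl) (hq _ _ rfl)
    · obtain ⟨rfl, rfl⟩ := cpair_inj.1 h
      exact hmul _ _ _ (hp _ _ rfl) (hq _ _ rfl)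

/-! #### Formulas -/

theorem Formula.eq {n s t : M} (h : Term n s) (h' : Term n t) :
    Formula n (cpair 5 (cpair s t)) := Der.base ⟨n, s, t, h, h', Or.inl rfl⟩

theorem Formula.box {n s : M} (h : Term n s) : Formula n (cpair 6 s) :=
  Der.base ⟨n, s, s, h, h, Or.inr rfl⟩

theorem Formula.binary {n A B c : M} (hc : c = 7 ∨ c = 8 ∨ c = 9) (h : Formula n A)
    (h' : Formula n B) : Formula n (cpair c (cpair A B)) :=
  Der.step h h' ⟨n, A, B, Or.inl ⟨rfl, rfl, by
    rcases hc with rfl | rfl | rfl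
    exacts [Or.inl rfl, Or.inr (Or.inl rfl), Or.inr (Or.inr rfl)]⟩⟩

theorem Formula.quantifier {n A c : M} (hc : c = 10 ∨ c = 11) (h : Formula (n + 1) A) :
    Formula n (cpair c A) :=
  Der.step h h ⟨n, A, A, Or.inr ⟨rfl, by
    rcases hc with rfl | rfl
    exacts [Or.inl rfl, Or.inr rfl]⟩⟩

theorem Formula.of_all {n A : M} (h : Formula n (cpair 10 A)) : Formula (n + 1) A := by
  rcases h.inv with ⟨m, s, t, -, -, h⟩ | ⟨p, q, hp, hq, m, B, C, h⟩
  · simp at h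
  · simp at h
    obtain ⟨rfl, rfl, rfl⟩ := h
    exact hp

theorem formula_all_iff {n A : M} : Formula n (cpair 10 A) ↔ Formula (n + 1) A :=
  ⟨Formula.of_all, Formula.quantifier (Or.inl rfl)⟩

/-- Induction on formulas. -/
theorem Formula.induction {P : M → M → Prop}
    (hP : Definable (fun y => ∀ n t, y = cpair n t → P n t))
    (heq : ∀ n s t, Term n s → Term n t → P n (cpair 5 (cpair s t)))
    (hbox : ∀ n s, Term n s → P n (cpair 6 s))
    (hbinary : ∀ n A B c, (c = 7 ∨ c = 8 ∨ c = 9) → P n A → P n B → P n (cpair c (cpair A B)))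
    (hquantifier : ∀ n A c, (c = 10 ∨ c = 11) → P (n + 1) A → P n (cpair c A))
    {n A : M} (h : Formula n A) : P n A := by
  refine Der.induction hP ?_ ?_ h n A rfl
  · rintro _ ⟨n, s, t, hs, ht, rfl | rfl⟩ n' t' h
    · obtain ⟨rfl, rfl⟩ := cpair_inj.1 h
      exact heq _ _ _ hs ht
    · obtain ⟨rfl, rfl⟩ := cpair_inj.1 h
      exact hbox _ _ hs
  · rintro _ p q - - hp hq ⟨n, A, B, ⟨rfl, rfl, h⟩ | ⟨rfl, h⟩⟩ n' t' rfl
    · simp only [cpair_inj] at h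
      rcases h with ⟨rfl, rfl⟩ | ⟨rfl, rfl⟩ | ⟨rfl, rfl⟩ <;>
        exact hbinary _ _ _ _ (by simp) (hp _ _ rfl) (hq _ _ rfl)
    · simp only [cpair_inj] at h
      rcases h with ⟨rfl, rfl⟩ | ⟨rfl, rfl⟩ <;>
        exact hquantifier _ _ _ (by simp) (hp _ _ rfl)

/-! #### Codes of actual terms and formulas -/

@[simp] theorem cast_npair (a b : ℕ) : ((npair a b : ℕ) : M) = cpair (a : M) b := by
  simp [npair, cpair]

theorem term_code {n : ℕ} (t : Tm n) : Term (n : M) t.code := by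
  induction t with
  | var i => simpa [Tm.code] using Term.var (M := M) (Nat.cast_lt.2 i.2)
  | zero => simpa [Tm.code] using Term.zero (n : M)
  | succ t ih => simpa [Tm.code] using ih.succ
  | add s t ihs iht => simpa [Tm.code] using ihs.add iht
  | mul s t ihs iht => simpa [Tm.code] using ihs.mul iht

theorem formula_code {n : ℕ} (A : Fml n) : Formula (n : M) A.code := by
  induction A with
  | eq s t => simpa [Fml.code] using Formula.eq (M := M) (term_code s) (term_code t)
  | box t => simpa [Fml.code] using Formula.box (M := M) (term_code t)
  | and A B ihA ihB => simpa [Fml.code] using Formula.binary (Or.inl rfl) ihA ihB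
  | or A B ihA ihB => simpa [Fml.code] using Formula.binary (Or.inr (Or.inl rfl)) ihA ihB
  | imp A B ihA ihB => simpa [Fml.code] using Formula.binary (Or.inr (Or.inr rfl)) ihA ihB
  | all A ih => simpa [Fml.code] using Formula.quantifier (Or.inl rfl) (by simpa using ih)
  | ex A ih => simpa [Fml.code] using Formula.quantifier (Or.inr rfl) (by simpa using ih)

theorem sentence_code (A : Fml 0) : Formula (0 : M) A.code := by
  simpa using formula_code (M := M) A

/-! #### Substitution -/

/-- `z` is the only result of putting `t` for the variable `j` in `x`. -/
def SubstTo (j t x z : M) : Prop := ∀ w, Subst j t x w ↔ w = z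

/-- As for the other constructors, existence is the matching clause of the derivation, and
uniqueness is inversion: the tags exclude all other clauses. -/
theorem SubstTo.zero (j t : M) : SubstTo j t (cpair 1 0) (cpair 1 0) := by
  intro w
  constructor
  · intro h
    rcases h.inv with ⟨j', t', h⟩ | ⟨p, q, hp, hq, j', t', a, a', b, b', h⟩
    · simp at h
      exact h.2.2
    · simp at h
  · rintro rfl
    exact Der.base ⟨j, t, Or.inr (Or.inl rfl)⟩

theorem SubstTo.var_self (j t : M) : SubstTo j t (cpair 0 j) t := by
  intro w
  constructor
  · intro h
    rcases h.inv with ⟨j', t', h⟩ | ⟨p, q, hp, hq, j', t', a, a', b, b', h⟩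
    · simp at h
      grind
    · simp at h
  · rintro rfl
    exact Der.base ⟨j, _, Or.inl rfl⟩

theorem SubstTo.var_of_ne {j i : M} (t : M) (h : i ≠ j) :
    SubstTo j t (cpair 0 i) (cpair 0 i) := by
  intro w
  constructor
  · intro h
    rcases h.inv with ⟨j', t', h⟩ | ⟨p, q, hp, hq, j', t', a, a', b, b', h⟩
    · simp at h
      grind
    · simp at h
  · rintro rfl
    exact Der.base ⟨j, t, Or.inr (Or.inr ⟨i, h, rfl⟩)⟩

theorem SubstTo.unary {j t x z c : M} (hc : c = 2 ∨ c = 6) (h : SubstTo j t x z) :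
    SubstTo j t (cpair c x) (cpair c z) := by
  intro w
  constructor
  · intro h'
    rcases h'.inv with ⟨j', t', h'⟩ | ⟨p, q, hp, hq, j', t', a, a', b, b', h'⟩
    · rcases hc with rfl | rfl <;> simp at h'
    · rcases hc with rfl | rfl <;> simp at h' <;>
      · obtain ⟨rfl, rfl, rfl, rfl, rfl⟩ := h'
        rw [(h a').1 hp]
  · rintro rfl
    have h1 := (h z).2 rfl
    refine Der.step h1 h1 ⟨j, t, x, z, x, z, Or.inl ⟨rfl, ?_⟩⟩
    rcases hc with rfl | rfl <;> simp

theorem SubstTo.binary {j t x z y u c : M}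
    (hc : c = 3 ∨ c = 4 ∨ c = 5 ∨ c = 7 ∨ c = 8 ∨ c = 9) (h : SubstTo j t x z)
    (hy : SubstTo j t y u) : SubstTo j t (cpair c (cpair x y)) (cpair c (cpair z u)) := by
  intro w
  constructor
  · intro h'
    rcases h'.inv with ⟨j', t', h'⟩ | ⟨p, q, hp, hq, j', t', a, a', b, b', h'⟩
    · rcases hc with rfl | rfl | rfl | rfl | rfl | rfl <;> simp at h'
    · rcases hc with rfl | rfl | rfl | rfl | rfl | rfl <;> simp at h' <;>
      · obtain ⟨rfl, rfl, rfl, rfl, ⟨rfl, rfl⟩, rfl⟩ := h'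
        rw [(h a').1 hp, (hy b').1 hq]
  · rintro rfl
    refine Der.step ((h z).2 rfl) ((hy u).2 rfl) ⟨j, t, x, z, y, u, Or.inr (Or.inl ⟨rfl, rfl, ?_⟩)⟩
    rcases hc with rfl | rfl | rfl | rfl | rfl | rfl <;> simp

theorem SubstTo.quantifier {j t x z c : M} (hc : c = 10 ∨ c = 11) (h : SubstTo (j + 1) t x z) :
    SubstTo j t (cpair c x) (cpair c z) := by
  intro w
  constructor
  · intro h'
    rcases h'.inv with ⟨j', t', h'⟩ | ⟨p, q, hp, hq, j', t', a, a', b, b', h'⟩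
    · rcases hc with rfl | rfl <;> simp at h'
    · rcases hc with rfl | rfl <;> simp at h' <;>
      · obtain ⟨rfl, rfl, rfl, rfl, rfl⟩ := h'
        rw [(h a').1 hp]
  · rintro rfl
    have h1 := (h z).2 rfl
    refine Der.step h1 h1 ⟨j, t, x, z, x, z, Or.inr (Or.inr ⟨rfl, ?_⟩)⟩
    rcases hc with rfl | rfl <;> simp

/-- The variable replaced is always the last one, `k` among `k + 1`. The others keep their indices,
and the result has `k` variables. -/
theorem Term.exists_substTo {m s : M} (hs : Term m s) {t : M} (ht : ∀ k, Term k t) :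
    ∀ k, m = k + 1 → ∃ s', Term k s' ∧ SubstTo k t s s' := by
  refine Term.induction (P := fun m s => ∀ k, m = k + 1 → ∃ s', Term k s' ∧ SubstTo k t s s')
    ⟨1, ∀₀ ∀₀ (#2 ≐ pr #1 #0 ⇒ ∀₀ (#2 ≐ Tm.succ #0 ⇒ ∃₀ (termF ⬝ ![#1, #0] ⋏
      ∀₀ ((substF ⬝ ![#2, #6, #3, #0]).iff (#0 ≐ #1))))), ![t], fun a => ?_⟩ ?_ ?_ ?_ ?_ ?_ hs
  · simp [SubstTo, Fml.iff, iff_def]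
  · exact fun n k _ => ⟨_, Term.zero k, SubstTo.zero k t⟩
  · rintro n i hi k rfl
    rcases (lt_add_one_iff'.1 hi).lt_or_eq with hi | rfl
    · exact ⟨_, Term.var hi, SubstTo.var_of_ne t hi.ne⟩
    · exact ⟨t, ht _, SubstTo.var_self _ _⟩
  · intro n s ih k hk
    obtain ⟨s', h1, h2⟩ := ih k hk
    exact ⟨_, h1.succ, h2.unary (by simp)⟩
  · intro n s s₂ ih ih₂ k hk
    obtain ⟨s', h1, h2⟩ := ih k hk
    obtain ⟨s₂', h3, h4⟩ := ih₂ k hk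
    exact ⟨_, h1.add h3, h2.binary (by simp) h4⟩
  · intro n s s₂ ih ih₂ k hk
    obtain ⟨s', h1, h2⟩ := ih k hk
    obtain ⟨s₂', h3, h4⟩ := ih₂ k hk
    exact ⟨_, h1.mul h3, h2.binary (by simp) h4⟩

/-- The index of the variable is quantified inside the induction, since under a quantifier both it
and the number of variables grow by one. -/
theorem Formula.exists_substTo {m A : M} (hA : Formula m A) {t : M} (ht : ∀ k, Term k t) :
    ∀ k, m = k + 1 → ∃ A', Formula k A' ∧ SubstTo k t A A' := by
  refine Formula.induction (P := fun m s => ∀ k, m = k + 1 → ∃ s', Formula k s' ∧ SubstTo k t s s')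
    ⟨1, ∀₀ ∀₀ (#2 ≐ pr #1 #0 ⇒ ∀₀ (#2 ≐ Tm.succ #0 ⇒ ∃₀ (formulaF ⬝ ![#1, #0] ⋏
      ∀₀ ((substF ⬝ ![#2, #6, #3, #0]).iff (#0 ≐ #1))))), ![t], fun a => ?_⟩ ?_ ?_ ?_ ?_ hA
  · simp [SubstTo, Fml.iff, iff_def]
  · intro n s s₂ hs hs₂ k hk
    obtain ⟨s', h1, h2⟩ := hs.exists_substTo ht k hk
    obtain ⟨s₂', h3, h4⟩ := hs₂.exists_substTo ht k hk
    exact ⟨_, Formula.eq h1 h3, h2.binary (by simp) h4⟩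
  · intro n s hs k hk
    obtain ⟨s', h1, h2⟩ := hs.exists_substTo ht k hk
    exact ⟨_, Formula.box h1, h2.unary (by simp)⟩
  · intro n A B c hc ihA ihB k hk
    obtain ⟨A', h1, h2⟩ := ihA k hk
    obtain ⟨B', h3, h4⟩ := ihB k hk
    exact ⟨_, h1.binary hc h3, h2.binary (by tauto) h4⟩
  · intro n A c hc ih k hk
    obtain ⟨A', h1, h2⟩ := ih (k + 1) (by rw [hk])
    exact ⟨_, h1.quantifier hc, h2.quantifier hc⟩

/-! #### Blocks of universal quantifiers -/

theorem alls_zero {a p : M} : Alls 0 a p ↔ p = a := by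
  constructor
  · intro h
    rcases h.inv with ⟨a', h⟩ | ⟨p', q, -, -, k, a', x, -, h⟩
    · simp at h
      rw [h.1, h.2]
    · simp only [cpair_inj] at h
      exact absurd h.1.symm (add_one_ne_zero' k)
  · rintro rfl
    exact Der.base ⟨_, rfl⟩

/-- The last step of the derivation adds the outermost quantifier, the one to be stripped in the
induction on `k`. -/
theorem alls_succ {k a p : M} : Alls (k + 1) a p ↔ ∃ x, p = cpair 10 x ∧ Alls k a x := by
  constructor
  · intro h
    rcases h.inv with ⟨a', h⟩ | ⟨p', q, hp, -, k', a', x, rfl, h⟩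
    · simp only [cpair_inj] at h
      exact absurd h.1 (add_one_ne_zero' k)
    · simp only [cpair_inj] at h
      obtain ⟨h1, rfl, rfl⟩ := h
      obtain rfl := add_one_inj h1
      exact ⟨x, rfl, hp⟩
  · rintro ⟨x, rfl, h⟩
    exact Der.step h h ⟨k, a, x, rfl, rfl⟩

theorem Alls.formula_iff {k a p : M} (h : Alls k a p) (j : M) :
    Formula j p ↔ Formula (j + k) a := by
  revert h
  refine Definable.induction (P := fun k : M => ∀ j p, Alls k a p →
    (Formula j p ↔ Formula (j + k) a)) ⟨1, ∀₀ ∀₀ (allsF ⬝ ![#2, #3, #0] ⇒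
      (formulaF ⬝ ![#1, #0]).iff (formulaF ⬝ ![Tm.add #1 #2, #3])), ![a], fun k => ?_⟩ ?_ ?_ k j p
  · simp [Fml.iff, iff_def]
  · intro j p h
    rw [alls_zero.1 h, _root_.add_zero]
  · intro k ih j p h
    obtain ⟨x, rfl, hx⟩ := alls_succ.1 h
    rw [formula_all_iff, ih (j + 1) x hx, show j + 1 + k = j + (k + 1) by ring]

/-- Variable `j` outside a block of `k` quantifiers is variable `j + k` in its matrix. -/
theorem Alls.exists_substTo {k a p : M} (h : Alls k a p) {j t a' : M}
    (ha : SubstTo (j + k) t a a') : ∃ p', Alls k a' p' ∧ SubstTo j t p p' := by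
  revert h ha
  refine Definable.induction (P := fun k : M => ∀ j p, Alls k a p → SubstTo (j + k) t a a' →
    ∃ p', Alls k a' p' ∧ SubstTo j t p p') ⟨3, ∀₀ ∀₀ (allsF ⬝ ![#2, #3, #0] ⇒
      ∀₀ ((substF ⬝ ![Tm.add #2 #3, #5, #4, #0]).iff (#0 ≐ #6)) ⇒
      ∃₀ (allsF ⬝ ![#3, #6, #0] ⋏ ∀₀ ((substF ⬝ ![#3, #6, #2, #0]).iff (#0 ≐ #1)))),
      ![a, t, a'], fun k => ?_⟩ ?_ ?_ k j p
  · simp [SubstTo, Fml.iff, iff_def]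
  · intro j p h ha
    rw [_root_.add_zero] at ha
    rw [alls_zero.1 h]
    exact ⟨a', alls_zero.2 rfl, ha⟩
  · intro k ih j p h ha
    obtain ⟨x, rfl, hx⟩ := alls_succ.1 h
    obtain ⟨p', h1, h2⟩ := ih (j + 1) x hx (by rwa [show j + 1 + k = j + (k + 1) by ring])
    exact ⟨_, alls_succ.2 ⟨p', rfl, h1⟩, h2.quantifier (Or.inl rfl)⟩

/-- `y` follows from `p` and `q` by modus ponens under `k` quantifiers, and all are sentences. -/
def SentenceMP (k p q y : M) : Prop :=
  ModusPonens k p q y ∧ Formula 0 p ∧ Formula 0 q ∧ Formula 0 y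

theorem SentenceMP.eq_imp {p q y : M} (h : SentenceMP 0 p q y) : q = cpair 9 (cpair p y) := by
  obtain ⟨⟨a, b, h1, h2, h3⟩, -⟩ := h
  rw [alls_zero.1 h1, alls_zero.1 h2, alls_zero.1 h3]

/-- Modus ponens under `k + 1` quantifiers, and instances of the outermost variable. -/
theorem SentenceMP.exists_instance {k p q y : M} (h : SentenceMP (k + 1) p q y) :
    ∃ p' q' y', p = cpair 10 p' ∧ q = cpair 10 q' ∧ y = cpair 10 y' ∧
      Formula 1 p' ∧ Formula 1 q' ∧ Formula 1 y' ∧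
      ∀ n t z, Numeral n t → Subst 0 t y' z →
        ∃ p'' q'', Subst 0 t p' p'' ∧ Subst 0 t q' q'' ∧ SentenceMP k p'' q'' z := by
  obtain ⟨⟨a, b, h1, h2, h3⟩, hp, hq, hy⟩ := h
  have ha := (h1.formula_iff 0).1 hp
  have hb := (h3.formula_iff 0).1 hy
  rw [_root_.zero_add] at ha hb
  obtain ⟨p', rfl, g1⟩ := alls_succ.1 h1
  obtain ⟨q', rfl, g2⟩ := alls_succ.1 h2
  obtain ⟨y', rfl, g3⟩ := alls_succ.1 h3
  refine ⟨p', q', y', rfl, rfl, rfl, ?_, ?_, ?_, fun n t z hn hz => ?_⟩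
  · simpa using formula_all_iff.1 hp
  · simpa using formula_all_iff.1 hq
  · simpa using formula_all_iff.1 hy
  -- The outermost of the `k + 1` bound variables has index `k` in the matrices. Substitution
  -- commutes with `→`, so the instances again have the shape of a modus ponens.
  obtain ⟨a', hfa, hsa⟩ := ha.exists_substTo hn.term k rfl
  obtain ⟨b', hfb, hsb⟩ := hb.exists_substTo hn.term k rfl
  have hsc := SubstTo.binary (c := 9) (by simp) hsa hsb
  have hfc := Formula.binary (c := 9) (by simp) hfa hfb
  have hk : k = 0 + k := (_root_.zero_add k).symm
  rw [hk] at hsa hsb hsc hfa hfb hfc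
  obtain ⟨p'', hp1, hp2⟩ := g1.exists_substTo hsa
  obtain ⟨q'', hq1, hq2⟩ := g2.exists_substTo hsc
  obtain ⟨z', hz1, hz2⟩ := g3.exists_substTo hsb
  obtain rfl := (hz2 z).1 hz
  exact ⟨p'', q'', (hp2 _).2 rfl, (hq2 _).2 rfl, ⟨a', b', hp1, hq1, hz1⟩,
    (hp1.formula_iff 0).2 hfa, (hq1.formula_iff 0).2 hfc, (hz1.formula_iff 0).2 hfb⟩

end ArithmetizedFormulas

/-! ### The assertibility predicate -/

/-! ### The formalized syntactic notions are arithmetical. -/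

section IsArith

@[simp] theorem Fml.isArith_app {k n : ℕ} (A : Fml k) (σ : Fin k → Tm n) :
    (A ⬝ σ).IsArith ↔ A.IsArith := Fml.isArith_subst σ A

@[simp] theorem isArith_neg {n : ℕ} (A : Fml n) : A.neg.IsArith ↔ A.IsArith :=
  and_iff_left trivial

@[simp] theorem isArith_leF : leF.IsArith := by simp [leF, Fml.IsArith]

@[simp] theorem isArith_ltF : ltF.IsArith := by simp [ltF, Fml.IsArith]

@[simp] theorem isArith_betaF : betaF.IsArith := by simp [betaF, Fml.IsArith]

theorem isArith_derivationF {base : Fml 1} {step : Fml 3} (hb : base.IsArith)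
    (hs : step.IsArith) : (derivationF base step).IsArith := by
  simp [derivationF, Fml.IsArith, hb, hs]

theorem isArith_derF {base : Fml 1} {step : Fml 3} (hb : base.IsArith)
    (hs : step.IsArith) : (derF base step).IsArith := by
  simp [derF, Fml.IsArith, isArith_derivationF hb hs]

@[simp] theorem isArith_numeralF : numeralF.IsArith :=
  (Fml.isArith_app _ _).2 (isArith_derF (by simp [Fml.IsArith]) (by simp [Fml.IsArith]))

@[simp] theorem isArith_termF : termF.IsArith :=
  (Fml.isArith_app _ _).2 (isArith_derF (by simp [Fml.IsArith]) (by simp [Fml.IsArith]))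

@[simp] theorem isArith_formulaF : formulaF.IsArith :=
  (Fml.isArith_app _ _).2 (isArith_derF (by simp [Fml.IsArith]) (by simp [Fml.IsArith]))

@[simp] theorem isArith_sentenceF : sentenceF.IsArith :=
  (Fml.isArith_app _ _).2 isArith_formulaF

@[simp] theorem isArith_substF : substF.IsArith :=
  (Fml.isArith_app _ _).2 (isArith_derF (by simp [Fml.IsArith]) (by simp [Fml.IsArith]))

@[simp] theorem isArith_substNumF : substNumF.IsArith := by simp [substNumF, Fml.IsArith]

@[simp] theorem isArith_allsF : allsF.IsArith :=
  (Fml.isArith_app _ _).2 (isArith_derF (by simp [Fml.IsArith]) (by simp [Fml.IsArith]))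

@[simp] theorem isArith_modusPonensF : modusPonensF.IsArith := by
  simp [modusPonensF, Fml.IsArith]

theorem isArith_proofF {Ax : Fml 1} (hAx : Ax.IsArith) : (proofF Ax).IsArith :=
  isArith_derivationF (by simp [Fml.IsArith, hAx]) (by simp [Fml.IsArith])

theorem isArith_provF {Ax : Fml 1} (hAx : Ax.IsArith) : (provF Ax).IsArith := by
  simp [provF, Fml.IsArith, isArith_proofF hAx]

theorem isArith_conF {Ax : Fml 1} (hAx : Ax.IsArith) : (conF Ax).IsArith := by
  simp [conF, Fml.IsArith, isArith_proofF hAx]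

end IsArith

/-! ### Passing between entailment and worlds, and the axioms for `□` in a world. -/

theorem Ent.mem {Θ : Set (Fml 0)} {n : ℕ} {Γ A : Fml n} (h : Ent Θ Γ A) {W : World Θ}
    {e : Fin n → W.M} (hΓ : W.Mem Γ e) : W.Mem A e :=
  W.mem_imp (W.mem_of_prv h e) hΓ

theorem Prv.of_forall_world {Θ : Set (Fml 0)} [LogicalTheory Θ] {n : ℕ} {A : Fml n}
    (h : ∀ (W : World Θ) (e : Fin n → W.M), W.Mem A e) : Prv Θ A :=
  Prv.mp (A := Tm.zero ≐ Tm.zero) (Ent.of_forall_world fun W e _ => h W e)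
    (Prv.logical (.eqRefl _))

/-- A universally quantified implication in two variables. -/
theorem Ent.all_all_imp {Θ : Set (Fml 0)} [LogicalTheory Θ] {n : ℕ} {Γ : Fml n}
    {A B : Fml (n + 2)} (h : ∀ (W : World Θ) (e : Fin n → W.M) a b, W.Mem Γ e →
      W.Mem A (Matrix.vecCons b (Matrix.vecCons a e)) →
      W.Mem B (Matrix.vecCons b (Matrix.vecCons a e))) : Ent Θ Γ (∀₀ ∀₀ (A ⇒ B)) := by
  refine Ent.all_intro (Ent.all_intro (Ent.curry (Ent.of_forall_world fun W e he => ?_)))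
  obtain ⟨b, e, rfl⟩ : ∃ b e', e = Matrix.vecCons b e' := ⟨_, _, (Matrix.cons_head_tail e).symm⟩
  obtain ⟨a, e, rfl⟩ : ∃ b e', e = Matrix.vecCons b e' := ⟨_, _, (Matrix.cons_head_tail e).symm⟩
  rw [W.mem_and, W.mem_weaken, W.mem_weaken] at he
  exact h W e a b he.1 he.2

/-- A universally quantified implication in three variables. -/
theorem Ent.all_all_all_imp {Θ : Set (Fml 0)} [LogicalTheory Θ] {n : ℕ} {Γ : Fml n}
    {A B : Fml (n + 3)} (h : ∀ (W : World Θ) (e : Fin n → W.M) a b c, W.Mem Γ e →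
      W.Mem A (Matrix.vecCons c (Matrix.vecCons b (Matrix.vecCons a e))) →
      W.Mem B (Matrix.vecCons c (Matrix.vecCons b (Matrix.vecCons a e)))) :
    Ent Θ Γ (∀₀ ∀₀ ∀₀ (A ⇒ B)) := by
  refine Ent.all_intro (Ent.all_all_imp fun W e b c he => ?_)
  obtain ⟨a, e, rfl⟩ : ∃ b e', e = Matrix.vecCons b e' := ⟨_, _, (Matrix.cons_head_tail e).symm⟩
  rw [W.mem_weaken] at he
  exact h W e a b c he

/-- The theories that contain Peano arithmetic, full induction and the axioms for `□`. -/
class BoxTheory (Θ : Set (Fml 0)) : Prop extends PATheory Θ where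
  prv_of_boxAxiom {n : ℕ} {A : Fml n} (h : BoxAxiom A) : Prv Θ A

namespace World

variable {Θ : Set (Fml 0)} (W : World Θ)

/-- The interpretation of `□`. -/
def Box (a : W.M) : Prop := W.Mem (Fml.box #0) ![a]

theorem mem_box {n : ℕ} (t : Tm n) (e : Fin n → W.M) : W.Mem (Fml.box t) e ↔ W.Box (t.eval e) := by
  have h := W.mem_subst (Fml.box #0) ![t] e
  rw [show (fun i => (![t] i).eval e) = ![t.eval e] from funext fun i => by fin_cases i; rfl] at h
  exact h

variable [BoxTheory Θ]

theorem box_imp {a b : W.M} (ha : Formula 0 a) (hb : Formula 0 b)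
    (h : W.Box (cpair 9 (cpair a b))) (h' : W.Box a) : W.Box b := by
  have h1 := W.mem_all (W.mem_all (W.mem_of_prv (BoxTheory.prv_of_boxAxiom .imp) ![]) a) b
  have h2 := W.mem_imp h1 ((W.mem_iff_sat (by simp [Fml.IsArith]) _).2 (by simp [ha, hb]))
  simpa [mem_box] using W.mem_imp (W.mem_imp h2 (by simpa [mem_box] using h))
    (by simpa [mem_box] using h')

/-- The right-hand side stays a formula in the world: if all its instances were merely members, its
own membership would not follow. -/
theorem box_all_iff {a : W.M} (ha : Formula 1 a) : W.Box (cpair 10 a) ↔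
    W.Mem (∀₀ ∀₀ (substNumF ⬝ ![Tm.zero, #1, #2, #0] ⇒ Fml.box #0)) ![a] := by
  have h1 := W.mem_all (W.mem_of_prv (BoxTheory.prv_of_boxAxiom .all) ![]) a
  have h2 := W.mem_imp h1 ((W.mem_iff_sat (by simp) _).2 (by simpa using ha))
  obtain ⟨h3, h4⟩ := (W.mem_and _ _ _).1 h2
  refine ⟨fun h => W.mem_imp h3 (by simpa [mem_box] using h), fun h => ?_⟩
  simpa [mem_box] using W.mem_imp h4 h

theorem box_of_box_all {a n t z : W.M} (ha : Formula 1 a) (h : W.Box (cpair 10 a))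
    (hn : Numeral n t) (hz : Subst 0 t a z) : W.Box z := by
  have h1 := W.mem_all (W.mem_all ((W.box_all_iff ha).1 h) n) z
  simpa [mem_box] using W.mem_imp h1 ((W.mem_iff_sat (by simp) _).2 (by simpa using ⟨t, hn, hz⟩))

/-- Capture without parameters; substituting no numerals leaves the code unchanged. -/
theorem box_of_mem {A : Fml 0} (h : W.Mem A ![]) : W.Box (A.code : W.M) := by
  have h1 := W.mem_imp (W.mem_of_prv (BoxTheory.prv_of_boxAxiom (.capture A)) ![]) h
  obtain ⟨a, ha⟩ := (W.mem_ex _ _).1 h1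
  obtain ⟨h2, h3⟩ := (W.mem_and _ _ _).1 ha
  have h4 := (W.mem_subst _ _ _).1 h2
  rw [substNumsF, W.mem_eq] at h4
  rw [mem_box] at h3
  simp only [Tm.eval_var, Fin.cases_zero, Fml.quote, eval_num, Matrix.cons_val_zero] at h3 h4
  rw [h4]
  exact h3

end World

/-! ### Soundness of modus ponens -/

/-- The formula that expresses `SentenceMP`. -/
def sentenceMPF : Fml 4 :=
  ∃₀ ∃₀ (allsF ⬝ ![#2, #1, #3] ⋏ allsF ⬝ ![#2, tag₂ 9 #1 #0, #4] ⋏ allsF ⬝ ![#2, #0, #5]) ⋏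
    sentenceF ⬝ ![#1] ⋏ sentenceF ⬝ ![#2] ⋏ sentenceF ⬝ ![#3]

@[simp] theorem sat_sentenceMPF {M : Type} [PAModel M] (k p q y : M) :
    sentenceMPF.Sat ![k, p, q, y] ↔ SentenceMP k p q y := by
  simp [sentenceMPF, SentenceMP, ModusPonens]

@[simp] theorem isArith_sentenceMPF : sentenceMPF.IsArith := by simp [sentenceMPF, Fml.IsArith]

/-- Modus ponens under `#0` quantifiers preserves assertibility. -/
def soundMPF : Fml 1 :=
  ∀₀ ∀₀ ∀₀ (sentenceMPF ⬝ ![#3, #2, #1, #0] ⋏ Fml.box #2 ⋏ Fml.box #1 ⇒ Fml.box #0)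

section

variable {Θ : Set (Fml 0)} [BoxTheory Θ]

theorem World.box_of_soundMPF (W : World Θ) {k p q y : W.M} (h : W.Mem soundMPF ![k])
    (hmp : SentenceMP k p q y) (hp : W.Box p) (hq : W.Box q) : W.Box y := by
  have h1 := W.mem_all (W.mem_all (W.mem_all h p) q) y
  have h2 := W.mem_imp h1 ((W.mem_and _ _ _).2
    ⟨(W.mem_iff_sat (by simp) _).2 (by simpa using hmp),
      (W.mem_and _ _ _).2 ⟨by simpa [W.mem_box] using hp, by simpa [W.mem_box] using hq⟩⟩)
  simpa [W.mem_box] using h2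

/-- Introduces the three quantifiers and the implication in the calculus, after which only a fact
about arbitrary worlds is left. It serves both the base (`t = 0`) and the step (`t = S x`) of the
induction. -/
theorem Ent.soundMPF_subst {n : ℕ} {Γ : Fml n} (t : Tm n)
    (h : ∀ (W : World Θ) (e : Fin n → W.M) p q y, W.Mem Γ e → SentenceMP (t.eval e) p q y →
      W.Box p → W.Box q → W.Box y) (σ : Fin 1 → Tm n) (hσ : σ 0 = t) :
    Ent Θ Γ (soundMPF.subst σ) := by
  subst hσ
  refine Ent.all_all_all_imp fun W e p q y hΓ hR => ?_
  have h1 := (W.mem_subst _ _ _).1 hR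
  refine (W.mem_subst (Fml.box #0) _ _).2 ?_
  rw [eval_up, eval_up, eval_up] at h1 ⊢
  rw [W.mem_and, W.mem_and, W.mem_iff_sat (by simp)] at h1
  simp [W.mem_box] at h1 ⊢
  exact h W e p q y hΓ h1.1 h1.2.1 h1.2.2

/-- What is known about a modus ponens under `#0 + 1` quantifiers, with formulas `∀ #1`, `∀ #2`,
`∀ #3`, when modus ponens under `#0` quantifiers is sound. -/
def soundMPHypF : Fml 4 :=
  soundMPF ⬝ ![#0] ⋏
    sentenceMPF ⬝ ![Tm.succ #0, tag₁ 10 #1, tag₁ 10 #2, tag₁ 10 #3] ⋏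
    Fml.box (tag₁ 10 #1) ⋏ Fml.box (tag₁ 10 #2)

theorem World.mem_soundMPHypF (W : World Θ) (k p q y : W.M) : W.Mem soundMPHypF ![k, p, q, y] ↔
    W.Mem soundMPF ![k] ∧ SentenceMP (k + 1) (cpair 10 p) (cpair 10 q) (cpair 10 y) ∧
      W.Box (cpair 10 p) ∧ W.Box (cpair 10 q) := by
  rw [soundMPHypF, W.mem_and, W.mem_and, W.mem_and, W.mem_iff_sat (A := sentenceMPF ⬝ _) (by simp),
    Fml.app, W.mem_subst, show (fun i => (![#0] i : Tm 4).eval ![k, p, q, y]) = ![k] from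
      funext fun i => by fin_cases i; rfl]
  simp [W.mem_box]

/-- The instances of the conclusion must be shown assertible under a universal quantifier, which one
world cannot introduce. So everything known is packed into the single formula `soundMPHypF`, the
quantifiers are introduced in the calculus, and `Ent.mem` brings the result back. -/
theorem ent_instances : Ent Θ soundMPHypF
    ((∀₀ ∀₀ (substNumF ⬝ ![Tm.zero, #1, #2, #0] ⇒ Fml.box #0)).subst ![#3]) := by
  refine Ent.all_all_imp fun W e n z hΓ hR => ?_
  obtain ⟨k, p, q, y, rfl⟩ : ∃ k p q y, e = ![k, p, q, y] :=
    ⟨e 0, e 1, e 2, e 3, funext fun i => by fin_cases i <;> rfl⟩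
  obtain ⟨h1, h2, h3, h4⟩ := (W.mem_soundMPHypF k p q y).1 hΓ
  have h5 := (W.mem_subst _ _ _).1 hR
  refine (W.mem_subst (Fml.box #0) _ _).2 ?_
  rw [eval_up, eval_up] at h5 ⊢
  rw [W.mem_iff_sat (by simp)] at h5
  simp [W.mem_box] at h5 ⊢
  obtain ⟨t, hn, hz⟩ := h5
  obtain ⟨p', q', y', hp, hq, hy, hfp, hfq, hfy, h6⟩ := h2.exists_instance
  obtain rfl := (cpair_inj.1 hp).2
  obtain rfl := (cpair_inj.1 hq).2
  obtain rfl := (cpair_inj.1 hy).2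
  obtain ⟨p'', q'', h7, h8, h9⟩ := h6 n t z hn hz
  exact W.box_of_soundMPF h1 h9 (W.box_of_box_all hfp h3 hn h7) (W.box_of_box_all hfq h4 hn h8)

/-- Induction on `k` inside the theory, for a formula with `□`: the axiom for `→` at `0`; at `k +
1`, the axiom for `∀` in both directions around `ent_instances`. -/
theorem prv_soundMPF : Prv Θ soundMPF := by
  -- The rule of induction is stated with a hypothesis; `0 = 0` is a vacuous one.
  have h : Ent Θ (Tm.zero ≐ Tm.zero) (∀₀ soundMPF) := by
    refine Ent.induction (PATheory.prv_of_induction (.mk _)) ?_ ?_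
    · refine Ent.soundMPF_subst Tm.zero (fun W e p q y _ hmp hp hq => ?_) _ rfl
      have h1 := SentenceMP.eq_imp hmp
      rw [h1] at hq
      exact W.box_imp hmp.2.1 hmp.2.2.2 hq hp
    · refine Ent.soundMPF_subst (Tm.succ #0) (fun W e p q y hΓ hmp hp hq => ?_) _ rfl
      obtain ⟨k, rfl⟩ : ∃ k, e = ![k] := ⟨e 0, funext fun i => by fin_cases i; rfl⟩
      rw [Tm.eval_succ, Tm.eval_var] at hmp
      obtain ⟨p', q', y', rfl, rfl, rfl, hfp, hfq, hfy, -⟩ := hmp.exists_instance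
      have h1 := ent_instances.mem ((W.mem_soundMPHypF k p' q' y').2
        ⟨((W.mem_and _ _ _).1 hΓ).2, hmp, hp, hq⟩)
      rw [W.mem_subst, show (fun i => (![#3] i : Tm 4).eval ![k, p', q', y']) = ![y'] from
        funext fun i => by fin_cases i; rfl] at h1
      exact (W.box_all_iff hfy).2 h1
  exact Prv.mp (A := (Tm.zero ≐ Tm.zero)) (B := ∀₀ soundMPF) h (Prv.logical (.eqRefl _))

theorem World.box_of_modusPonens (W : World Θ) {k p q y : W.M}
    (hmp : SentenceMP k p q y) (hp : W.Box p) (hq : W.Box q) : W.Box y :=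
  W.box_of_soundMPF (W.mem_of_prv prv_soundMPF ![k]) hmp hp hq

end

/-! ### Soundness of proofs -/

theorem sat_proofF {M : Type} [PAModel M] (Ax : Fml 1) (c d n y : M) :
    (proofF Ax).Sat ![cpair c (cpair d n), y] ↔ Beta y c d n ∧
      IsDerivation (fun z => Formula 0 z ∧ (Ax.Sat ![z] ∨ z = ((jump Ax).code : M)))
        (fun z p q => Formula 0 z ∧ ∃ k, ModusPonens k p q z) c d n := by
  rw [proofF, sat_derivationF]
  simp only [cpair_inj]
  simp [Fml.quote]

/-- The entries with number less than `#0` and at most `#3` of the sequence coded by `#1, #2` are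
assertible (`#4` is a dummy). -/
def soundUpToF : Fml 5 :=
  ∀₀ ∀₀ (ltF ⬝ ![#1, #2] ⋏ leF ⬝ ![#1, #5] ⋏ betaF ⬝ ![#0, #3, #4, #1] ⇒ Fml.box #0)

section

variable {Θ : Set (Fml 0)} [BoxTheory Θ] {Ax : Fml 1}

theorem World.box_of_soundUpToF (W : World Θ) {i c d n y j z : W.M}
    (h : W.Mem soundUpToF ![i, c, d, n, y]) (hj : j < i) (hjn : j ≤ n) (hz : Beta z c d j) :
    W.Box z := by
  have h1 := W.mem_all (W.mem_all h j) z
  have h2 := W.mem_imp h1 ((W.mem_iff_sat (by simp [Fml.IsArith]) _).2 (by simp [hj, hjn, hz]))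
  simpa [W.mem_box] using h2

theorem Ent.soundUpToF_subst {m : ℕ} {Γ : Fml m} (σ : Fin 5 → Tm m)
    (h : ∀ (W : World Θ) (e : Fin m → W.M) j z, W.Mem Γ e → j < (σ 0).eval e →
      j ≤ (σ 3).eval e → Beta z ((σ 1).eval e) ((σ 2).eval e) j → W.Box z) :
    Ent Θ Γ (soundUpToF.subst σ) := by
  refine Ent.all_all_imp fun W e j z hΓ hR => ?_
  have h1 := (W.mem_subst _ _ _).1 hR
  refine (W.mem_subst (Fml.box #0) _ _).2 ?_
  rw [eval_up, eval_up] at h1 ⊢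
  rw [W.mem_iff_sat (by simp [Fml.IsArith])] at h1
  simp [W.mem_box] at h1 ⊢
  exact h W e j z hΓ h1.1 h1.2.1 h1.2.2

/-- The number `⟨#0, ⟨#1, #2⟩⟩` is the code of a proof of `#3`. -/
def proofTripleF (Ax : Fml 1) : Fml 4 := proofF Ax ⬝ ![tr #0 #1 #2, #3]

theorem World.mem_proofTripleF (W : World Θ) (hAx : Ax.IsArith) (c d n y : W.M) :
    W.Mem (proofTripleF Ax) ![c, d, n, y] ↔ (proofF Ax).Sat ![cpair c (cpair d n), y] := by
  rw [proofTripleF, W.mem_iff_sat (by simp [isArith_proofF hAx])]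
  simp

/-- Supplies the side conditions of `SentenceMP`: both clauses for the entries of a proof demand
sentences. -/
theorem sentenceMP_of_isDerivation {M : Type} [PAModel M] {P : M → Prop}
    {St : M → M → M → Prop} {c d n j p : M}
    (h : IsDerivation (fun z => Formula 0 z ∧ P z) (fun z p q => Formula 0 z ∧ St z p q) c d n)
    (hj : j ≤ n) (hp : Beta p c d j) : Formula 0 p := by
  rcases (h.mono hj).inv hp with h | ⟨_, _, _, _, h⟩
  exacts [h.1, h.1]

/-- Induction on the position inside the theory. An entry is a main axiom (jump axiom), the jump
axiom itself (capture), or a modus ponens from earlier entries (`box_of_modusPonens`). -/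
theorem ent_soundUpToF (hAx : Ax.IsArith) (hj : Prv Θ (jump Ax)) :
    Ent Θ (proofTripleF Ax) (∀₀ soundUpToF) := by
  refine Ent.induction (PATheory.prv_of_induction (.mk _)) ?_ ?_
  · refine Ent.soundUpToF_subst _ fun W e j z _ h _ _ => ?_
    exact absurd h not_lt_zero
  · refine Ent.soundUpToF_subst _ fun W e j z hΓ hji hjn hz => ?_
    obtain ⟨i, c, d, n, y, rfl⟩ : ∃ i c d n y, e = ![i, c, d, n, y] :=
      ⟨e 0, e 1, e 2, e 3, e 4, funext fun i => by fin_cases i <;> rfl⟩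
    obtain ⟨h1, h2⟩ := (W.mem_and _ _ _).1 hΓ
    rw [W.mem_weaken, W.mem_proofTripleF hAx, sat_proofF] at h1
    obtain ⟨-, hd⟩ := h1
    rw [show ((Fin.cases (motive := fun _ => Tm 5) (Tm.succ #0) (fun i => #(Fin.succ i)) 0)).eval
      ![i, c, d, n, y] = i + 1 by simp] at hji
    change j ≤ n at hjn
    change Beta z c d j at hz
    rcases (lt_add_one_iff'.1 hji).lt_or_eq with hji | rfl
    · exact W.box_of_soundUpToF h2 hji hjn hz
    · obtain ⟨z', hz', h⟩ := hd j hjn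
      obtain rfl := hz'.unique hz
      rcases h with ⟨-, h | rfl⟩ | ⟨k, l, p, q, hk, hl, hp, hq, hs, r, hmp⟩
      · have h3 := W.mem_imp (W.mem_all (W.mem_of_prv hj ![]) z') ((W.mem_iff_sat hAx _).2 h)
        exact h3
      · exact W.box_of_mem (W.mem_of_prv hj ![])
      · exact W.box_of_modusPonens ⟨hmp, sentenceMP_of_isDerivation hd (hk.le.trans hjn) hp,
          sentenceMP_of_isDerivation hd (hl.le.trans hjn) hq, hs⟩
          (W.box_of_soundUpToF h2 hk (hk.le.trans hjn) hp)
          (W.box_of_soundUpToF h2 hl (hl.le.trans hjn) hq)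

theorem World.box_of_proofF (W : World Θ) (hAx : Ax.IsArith) (hj : Prv Θ (jump Ax)) {x y : W.M}
    (h : (proofF Ax).Sat ![x, y]) : W.Box y := by
  have h1 := h
  rw [proofF, sat_derivationF] at h1
  obtain ⟨c, d, n, rfl, hy, -⟩ := h1
  have h2 := (ent_soundUpToF hAx hj).mem ((W.mem_proofTripleF hAx c d n y).2 h)
  -- The bound is strict, so the last entry, number `n`, is reached at `n + 1`.
  exact W.box_of_soundUpToF (W.mem_all h2 (n + 1)) (lt_add_one_iff'.2 le_rfl) le_rfl hy

/-- Assertible soundness. -/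
theorem prv_soundness (hAx : Ax.IsArith) (hj : Prv Θ (jump Ax)) :
    Prv Θ (∀₀ (provF Ax ⇒ Fml.box #0)) := by
  -- The closure of an open formula is definitionally its `∀₀`, so the quantified variable becomes a
  -- parameter of the world.
  refine Prv.of_forall_world (n := 1) (A := provF Ax ⇒ Fml.box #0) fun W e => W.mem_of_prv ?_ e
  refine Ent.of_forall_world fun W e h => ?_
  obtain ⟨g, rfl⟩ : ∃ g, e = ![g] := ⟨e 0, funext fun i => by fin_cases i; rfl⟩
  rw [W.mem_iff_sat (isArith_provF hAx)] at h
  simp [provF] at h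
  obtain ⟨x, h⟩ := h
  exact W.box_of_proofF hAx hj h

/-- Assertible consistency. -/
theorem prv_box_consistency (hAx : Ax.IsArith) (hj : Prv Θ (jump Ax)) :
    Prv Θ (Fml.box (conF Ax).quote : Fml 0) := by
  refine Prv.of_forall_world fun W e => ?_
  obtain rfl : e = ![] := Subsingleton.elim _ _
  rw [W.mem_box, Fml.quote, eval_num]
  -- A case distinction on truth in the model is legitimate, since the world decides arithmetical
  -- sentences. In the second case the proof of `0 = 1` may be nonstandard, and soundness inside the
  -- theory covers it.
  by_cases h : (conF Ax).Sat (![] : Fin 0 → W.M)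
  · exact W.box_of_mem ((W.mem_iff_sat (isArith_conF hAx) _).2 h)
  · have h1 : ∃ x, (proofF Ax).Sat ![x, ((Fml.bot : Fml 0).code : W.M)] := by
      by_contra! hx
      exact h (by simpa [conF, Fml.neg, Fml.bot, Fml.quote] using hx)
    obtain ⟨x, hx⟩ := h1
    have h2 := W.box_of_mem (W.mem_of_prv (Prv.logical (.exFalso (conF Ax))) ![])
    simp only [Fml.code, cast_npair] at h2
    exact W.box_imp (sentence_code _) (sentence_code _) h2 (W.box_of_proofF hAx hj hx)

end

/-- A PA axiom need not be an axiom of `S`, only a theorem; its derivation uses logical axioms and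
members of `S`, all of which are main axioms. -/
theorem boxTheory_of_subset {S Θ : Set (Fml 0)}
    (hPA : ∀ A : Fml 0, ArithTheorem PA A → ArithTheorem S A) (h : mainAxioms S ⊆ Θ) : BoxTheory Θ where
  mem_of_logical {n A} hA := h (Or.inr ⟨n, A, Or.inr (Or.inl hA), rfl⟩)
  prv_of_paAxiom {n A} hA := by
    refine Derivable.mono ?_ (hPA (alls n A) (.ax (Or.inr ⟨n, A, hA, rfl⟩)))
    rintro C (⟨m, B, hB, -, rfl⟩ | hC)
    · exact h (Or.inr ⟨m, B, Or.inr (Or.inl hB), rfl⟩)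
    · exact h (Or.inl hC)
  prv_of_induction {n A} hA := .ax (h (Or.inr ⟨n, A, Or.inl hA, rfl⟩))
  prv_of_boxAxiom {n A} hA := .ax (h (Or.inr ⟨n, A, Or.inr (Or.inr hA), rfl⟩))

end Assertibility

theorem theorem3p1
    (S : Set (Fml 0))
    (hArith : ∀ A ∈ S, A.IsArith)
    (hRec : ComputablePred (fun g : ℕ => ∃ A ∈ S, A.code = g))
    (hPA : ∀ A : Fml 0, ArithTheorem PA A → ArithTheorem S A)
    (Ax : Fml 1)
    (hAx : ExpressesMainAxioms S Ax) :
    BoxTheorem S Ax (Fml.all (Fml.imp (provF Ax) (Fml.box (Tm.var 0)))) ∧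
      BoxTheorem S Ax (Fml.box (conF Ax).quote) := by
  have := boxTheory_of_subset hPA (Set.subset_union_left : _ ⊆ mainAxioms S ∪ {jump Ax})
  have hj : Prv (mainAxioms S ∪ {jump Ax}) (jump Ax) := .ax (Or.inr rfl)
  exact ⟨prv_soundness hAx.isArith hj, prv_box_consistency hAx.isArith hj⟩
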